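/- Let $k$ be a commutative integral domain, let $n\ge 0$, and let $p_{ij}\in k^\times$ ($1\le i<j\le n$) be roots of unity; put $p_{ji}=p_{ij}^{-1}$ for $i<j$ and $p_{ii}=1$. Let $A=k_{p_{ij}}[x_1,\dots,x_n]$ be the skew polynomial ring, that is, the $k$-algebra generated by $x_1,\dots,x_n$ subject to the relations $x_jx_i=p_{ij}x_ix_j$ for $i<j$. For $1\le s\le n$ let $$T_s=\Big\{(d_j)_{j\ne s}\in\mathbb N^{n-1} \;:\; \prod_{j\neq s}p_{ij}^{d_j}=p_{is}\ \text{ for all } i\ne s\Big\}.$$ A higher derivation of $A$ is a sequence $\partial=(\partial_i)_{i\ge 0}$ of $k$-linear endomorphisms of $A$ with $\partial_0=\mathrm{id}_A$ and $\partial_m(ab)=\sum_{i=0}^m\partial_i(a)\partial_{m-i}(b)$ for all $a,b\in A$ and $m\ge 0$. It is iterative if $\partial_i\partial_j=\binom{i+j}{i}\partial_{i+j}$ for all $i,j\geq 0$. It is locally nilpotent if for every $a\in A$ one has $\partial_i(a)=0$ for all sufficiently large $i$, and the map $A[t]\to A[t]$ given by $a\mapsto\sum_{i\ge 0}\partial_i(a)t^i$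 for $a\in A$ and $t\mapsto t$ is a $k$-algebra automorphism. Put $\ker\partial=\bigcap_{i\ge1}\ker\partial_i$. Let $\mathrm{ML}^H(A)$ (respectively $\mathrm{ML}^I(A)$) be the intersection of $\ker\partial$ over all locally nilpotent (respectively, all locally nilpotent iterative) higher derivations $\partial$ of $A$. 1. If $k$ contains $\mathbb Z$ (that is, $k$ has characteristic zero), then $\mathrm{ML}^I(A)$ is the $k$-subalgebra of $A$ generated by $\{x_s : T_s=\emptyset\}$. 2. $\mathrm{ML}^H(A)$ is the $k$-subalgebra of $A$ generated by $\{x_s : T_s=\emptyset\}$. In each case the invariant is itself a skew polynomial ring: if $s_1<\dots<s_m$ are the indices $s$ with $T_s=\emptyset$, there is a $k$-algebra isomorphism from $k_{q_{ij}}[y_1,\dots,y_m]$, with $q_{ij}=p_{s_is_j}$, onto the invariant that sends $y_i$ to $x_{s_i}$ for every $i$. -/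

import Mathlib

/-- A parameter family `p i j ∈ kˣ` normalised by `p i i = 1` and `p j i = (p i j)⁻¹`; equivalently,
a free choice of the entries with `i < j`. -/
structure IsMultAntisymm {k : Type*} [CommRing k] {n : ℕ} (p : Fin n → Fin n → kˣ) : Prop where
  diag : ∀ i, p i i = 1
  inv : ∀ i j, p j i = (p i j)⁻¹

/-- The defining relations `x_j x_i = p_{ij} x_i x_j` for `i < j`. -/
inductive SkewPolynomialRing.Rel (k : Type*) [CommRing k] {n : ℕ} (p : Fin n → Fin n → kˣ) :
    FreeAlgebra k (Fin n) → FreeAlgebra k (Fin n) → Prop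
  | comm (i j : Fin n) (h : i < j) :
      Rel k p (FreeAlgebra.ι k j * FreeAlgebra.ι k i)
        ((p i j : k) • (FreeAlgebra.ι k i * FreeAlgebra.ι k j))

/-- The skew polynomial ring `k_{p_{ij}}[x_1, …, x_n]`, as a quotient of the free algebra. -/
def SkewPolynomialRing (k : Type*) [CommRing k] {n : ℕ} (p : Fin n → Fin n → kˣ) : Type _ :=
  RingQuot (SkewPolynomialRing.Rel k p)

namespace SkewPolynomialRing

variable (k : Type*) [CommRing k] {n : ℕ} (p : Fin n → Fin n → kˣ)

instance instRing : Ring (SkewPolynomialRing k p) :=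
  inferInstanceAs (Ring (RingQuot (Rel k p)))

instance instAlgebra : Algebra k (SkewPolynomialRing k p) :=
  inferInstanceAs (Algebra k (RingQuot (Rel k p)))

/-- The generator `x_i`. -/
def x (i : Fin n) : SkewPolynomialRing k p :=
  RingQuot.mkAlgHom k (Rel k p) (FreeAlgebra.ι k i)

end SkewPolynomialRing

/-- The set `T_s` of tuples `(d_j)_{j ≠ s}` of natural numbers such that
`∏_{j ≠ s} p_{ij}^{d_j} = p_{is}` for all `i ≠ s`. -/
def exponentSet {k : Type*} [CommRing k] {n : ℕ} (p : Fin n → Fin n → kˣ) (s : Fin n) :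
    Set ({j : Fin n // j ≠ s} → ℕ) :=
  {d | ∀ i, i ≠ s → ∏ j : {j : Fin n // j ≠ s}, p i j ^ d j = p i s}

/-- Higher (Hasse–Schmidt) derivations of a `k`-algebra. -/
structure HigherDerivation (k A : Type*) [CommRing k] [Ring A] [Algebra k A] where
  /-- The sequence of `k`-linear endomorphisms. -/
  D : ℕ → (A →ₗ[k] A)
  D_zero : D 0 = LinearMap.id
  leibniz : ∀ (m : ℕ) (a b : A),
    D m (a * b) = ∑ i ∈ Finset.range (m + 1), D i a * D (m - i) b

namespace HigherDerivation

variable {k A : Type*} [CommRing k] [Ring A] [Algebra k A]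

/-- `∂_i ∘ ∂_j = (i + j choose i) ∂_{i+j}`. -/
def IsIterative (d : HigherDerivation k A) : Prop :=
  ∀ (i j : ℕ) (a : A), d.D i (d.D j a) = (i + j).choose i • d.D (i + j) a

/-- Local nilpotency: every element is killed by all but finitely many `∂_i`, and the map
`G_{∂,t} : A[t] → A[t]`, `a ↦ ∑_i ∂_i(a) t^i`, `t ↦ t`, is a `k`-algebra automorphism. -/
structure IsLocallyNilpotent (d : HigherDerivation k A) : Prop where
  eventually_zero : ∀ a : A, ∃ m : ℕ, ∀ i, m ≤ i → d.D i a = 0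
  automorphism : ∃ G : Polynomial A ≃ₐ[k] Polynomial A,
    G Polynomial.X = Polynomial.X ∧
      ∀ (a : A) (i : ℕ), (G (Polynomial.C a)).coeff i = d.D i a

/-- The kernel `⋂_{i ≥ 1} ker ∂_i`, which is a subalgebra. -/
def ker (d : HigherDerivation k A) : Subalgebra k A where
  carrier := {a | ∀ i, 1 ≤ i → d.D i a = 0}
  add_mem' := by
    intro a b ha hb i hi
    rw [map_add, ha i hi, hb i hi, add_zero]
  mul_mem' := by
    intro a b ha hb m hm
    rw [d.leibniz]
    refine Finset.sum_eq_zero fun i _ => ?_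
    rcases Nat.eq_zero_or_pos i with rfl | h
    · rw [hb (m - 0) (by omega), mul_zero]
    · rw [ha i h, zero_mul]
  algebraMap_mem' := by
    intro r i hi
    have h1 : ∀ m, 1 ≤ m → d.D m (1 : A) = 0 := by
      intro m
      induction m using Nat.strong_induction_on with
      | _ m ih =>
        intro hm
        have h := d.leibniz m 1 1
        obtain ⟨l, rfl⟩ : ∃ l, m = l + 1 := ⟨m - 1, by omega⟩
        rw [mul_one, Finset.sum_range_succ, Finset.sum_range_succ', Finset.sum_eq_zero] at h
        · simpa [d.D_zero] using h
        · intro j hj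
          have hj' := Finset.mem_range.mp hj
          rw [ih (j + 1) (by omega) (by omega), zero_mul]
    rw [Algebra.algebraMap_eq_smul_one, map_smul, h1 i hi, smul_zero]

end HigherDerivation

/-- `ML^H(A)`: the intersection of the kernels of all locally nilpotent higher derivations. -/
def MLH (k A : Type*) [CommRing k] [Ring A] [Algebra k A] : Subalgebra k A :=
  ⨅ (d : HigherDerivation k A) (_ : d.IsLocallyNilpotent), d.ker

/-- `ML^I(A)`: the intersection of the kernels of all locally nilpotent iterative higher
derivations. -/
def MLI (k A : Type*) [CommRing k] [Ring A] [Algebra k A] : Subalgebra k A :=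
  ⨅ (d : HigherDerivation k A) (_ : d.IsLocallyNilpotent ∧ d.IsIterative), d.ker

/-! Both invariants are squeezed: `MLH` lies in `MLI`, so it suffices to bound `MLI` above and `MLH`
below by the subalgebra generated by the `x_s` with `T_s` empty.

Upper bound (`MLI_le`). An element of `T_s` yields a monomial `y` in the other variables that
commutes with every generator exactly as `x_s` does. Hence `x_s ↦ x_s + y t`, fixing the other
generators, is an algebra map, with inverse obtained from `-y`. Its coefficients form a locally
nilpotent iterative higher derivation, whose kernel only contains elements not involving `x_s`.

Lower bound (`adjoin_le_MLH`). The parameters are roots of unity, so `A` has many central monomials.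
Let `g_s` be the least positive exponent of `x_s` in one of them. If `T_s` is empty then `g_s > 1`.
The obstruction is a noncommutative different. The projection onto the span of the central monomials
acts as a trace to the centre, and its kernel is described intrinsically by commutators
(`traceless`). The conductor of the resulting inverse different (`ringDifferent`) is therefore
preserved by every ring automorphism. For a ring with a monomial basis it contains the monomial with
exponents `g_s - 1`, and all its elements are multiples of that monomial.

This applies to `A[t]`, where the central variable `t` has period one and so is absent from the
generator. The automorphism of `A[t]` attached to a locally nilpotent higher derivation maps the
generator to a divisor of the generator, hence, `A[t]` being a domain, to an element of degree zero
in `t`. If `g_s > 1`, then `x_s` is a factor of the generator, so its image also has degree zero,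
which says that `∂_i(x_s) = 0` for `i ≥ 1`. -/

open Module

/-! ### The different of a ring -/

section Different

variable (B : Type*) [Ring B]

/-- The additive subgroup generated by all commutators. -/
def commutatorAddSubgroup : AddSubgroup B :=
  AddSubgroup.closure {y | ∃ a b : B, y = a * b - b * a}

/-- The elements having a nonzero central multiple that is a sum of commutators. -/
def traceless : Set B :=
  {x | ∃ c ∈ Subring.center B, c ≠ 0 ∧ c * x ∈ commutatorAddSubgroup B}

variable {B}

/-- The trace of every element of `b B` is divisible by `z` in the centre. -/
def TraceDvd (z b : B) : Prop :=
  ∀ a : B, ∃ ζ ∈ Subring.center B, b * a - z * ζ ∈ traceless B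

variable (B)

/-- The conductor of the inverse different `{z⁻¹ b | TraceDvd z b}` into the ring. -/
def ringDifferent : Set B :=
  {a | ∀ z ∈ Subring.center B, z ≠ 0 → ∀ b : B, TraceDvd z b → ∃ d, a * b = z * d}

variable {B}

theorem map_mem_center (G : B ≃+* B) {z : B} (hz : z ∈ Subring.center B) :
    G z ∈ Subring.center B := by
  rw [Subring.mem_center_iff] at hz ⊢
  intro g
  have := congrArg G (hz (G.symm g))
  simpa using this

theorem map_mem_commutatorAddSubgroup (G : B ≃+* B) {x : B} (hx : x ∈ commutatorAddSubgroup B) :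
    G x ∈ commutatorAddSubgroup B := by
  refine AddSubgroup.closure_induction (p := fun x _ => G x ∈ commutatorAddSubgroup B)
    ?_ ?_ ?_ ?_ hx
  · rintro _ ⟨a, b, rfl⟩
    exact AddSubgroup.subset_closure ⟨G a, G b, by simp⟩
  · simp
  · intro x y _ _ hx hy
    rw [map_add]
    exact add_mem hx hy
  · intro x _ hx
    rw [map_neg]
    exact neg_mem hx

theorem map_mem_traceless (G : B ≃+* B) {x : B} (hx : x ∈ traceless B) : G x ∈ traceless B := by
  obtain ⟨c, hc, hc0, h⟩ := hx
  refine ⟨G c, map_mem_center G hc, by simpa using hc0, ?_⟩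
  rw [← map_mul]
  exact map_mem_commutatorAddSubgroup G h

theorem TraceDvd.map (G : B ≃+* B) {z b : B} (h : TraceDvd z b) : TraceDvd (G z) (G b) := by
  intro a
  obtain ⟨ζ, hζ, h'⟩ := h (G.symm a)
  refine ⟨G ζ, map_mem_center G hζ, ?_⟩
  simpa using map_mem_traceless G h'

theorem map_mem_ringDifferent (G : B ≃+* B) {a : B} (ha : a ∈ ringDifferent B) :
    G a ∈ ringDifferent B := by
  intro z hz hz0 b hb
  obtain ⟨d, hd⟩ := ha (G.symm z) (map_mem_center G.symm hz) (by simpa using hz0) _ (hb.map G.symm)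
  refine ⟨G d, ?_⟩
  simpa using congrArg G hd

theorem zero_mem_traceless [Nontrivial B] : (0 : B) ∈ traceless B :=
  ⟨1, one_mem _, one_ne_zero, by simp⟩

/-- A common central multiplier is the product of the two given ones: it is nonzero in a domain, and
central multiples of commutators are commutators. -/
theorem add_mem_traceless [NoZeroDivisors B] {x y : B} (hx : x ∈ traceless B) (hy : y ∈ traceless B) :
    x + y ∈ traceless B := by
  have key : ∀ {c x : B}, c ∈ Subring.center B → x ∈ commutatorAddSubgroup B →
      c * x ∈ commutatorAddSubgroup B := by
    intro c x hc hx
    rw [Subring.mem_center_iff] at hc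
    refine AddSubgroup.closure_induction (p := fun x _ => c * x ∈ commutatorAddSubgroup B)
      ?_ ?_ ?_ ?_ hx
    · rintro _ ⟨a, b, rfl⟩
      refine AddSubgroup.subset_closure ⟨c * a, b, ?_⟩
      rw [mul_sub, mul_assoc, ← mul_assoc b c a, hc b, mul_assoc]
    · simp
    · intro x y _ _ hx hy
      rw [mul_add]
      exact add_mem hx hy
    · intro x _ hx
      rw [mul_neg]
      exact neg_mem hx
  obtain ⟨c, hc, hc0, hcx⟩ := hx
  obtain ⟨c', hc', hc0', hcy⟩ := hy
  refine ⟨c * c', mul_mem hc hc', mul_ne_zero hc0 hc0', ?_⟩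
  rw [mul_add]
  refine add_mem ?_ ?_
  · rw [← Subring.mem_center_iff.1 hc c', mul_assoc]
    exact key hc' hcx
  · rw [mul_assoc]
    exact key hc hcy

end Different

/-! ### Monomial bases -/

/-- The commutation character of the monomial with exponent `a`. -/
def commChar {G σ : Type*} [CommGroup G] [Fintype σ] (q : σ → σ → G) (a : σ → ℕ) : σ → G :=
  fun i => ∏ j, q i j ^ a j

section CommChar

variable {G σ : Type*} [CommGroup G] [Fintype σ] (q : σ → σ → G)

theorem commChar_add (a b : σ → ℕ) : commChar q (a + b) = commChar q a * commChar q b := by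
  ext i; simp [commChar, pow_add, Finset.prod_mul_distrib]

theorem commChar_nsmul (r : ℕ) (a : σ → ℕ) : commChar q (r • a) = commChar q a ^ r := by
  ext i; simp [commChar, pow_mul', Finset.prod_pow]

theorem commChar_single [DecidableEq σ] (s : σ) (r : ℕ) (i : σ) :
    commChar q (Pi.single s r) i = q i s ^ r := by
  unfold commChar
  rw [Finset.prod_eq_single s]
  · simp
  · intro j _ hj
    simp [hj]
  · simp

end CommChar

/-- A basis of an algebra indexed by exponent vectors, whose members multiply like monomials in
generators commuting up to the units `q i j`. -/
structure IsMonomialBasis {k B σ : Type*} [CommRing k] [Ring B] [Algebra k B] [Fintype σ]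
    [DecidableEq σ] (m : Basis (σ → ℕ) k B) (q : σ → σ → kˣ) : Prop where
  one : m 0 = 1
  mul : ∀ a b, ∃ u : kˣ, m a * m b = (u : k) • m (a + b)
  comm : ∀ i a, m (Pi.single i 1) * m a = ((commChar q a i : kˣ) : k) • (m a * m (Pi.single i 1))

namespace IsMonomialBasis

variable {k B σ : Type*} [CommRing k] [Ring B] [Algebra k B] [Fintype σ] [DecidableEq σ]
  {m : Basis (σ → ℕ) k B} {q : σ → σ → kˣ}

theorem mul' (hm : IsMonomialBasis m q) (a b : σ → ℕ) :
    ∃ u : kˣ, m (a + b) = (u : k) • (m a * m b) := by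
  obtain ⟨u, hu⟩ := hm.mul a b
  exact ⟨u⁻¹, by rw [hu, smul_smul, Units.inv_mul, one_smul]⟩

theorem nontrivial [Nontrivial k] (hm : IsMonomialBasis m q) : Nontrivial B :=
  ⟨1, 0, by rw [← hm.one]; exact m.ne_zero 0⟩

theorem repr_mul_right (hm : IsMonomialBasis m q) (a w : σ → ℕ) :
    ∃ u : kˣ, ∀ b : B, m.repr (b * m w) (a + w) = u * m.repr b a := by
  choose c hc using hm.mul
  refine ⟨c a w, fun b => ?_⟩
  have : (m.coord (a + w)) ∘ₗ LinearMap.mulRight k (m w) = (c a w : k) • m.coord a := by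
    refine m.ext fun v => ?_
    simp only [LinearMap.comp_apply, LinearMap.mulRight_apply, hc, LinearMap.smul_apply, map_smul,
      Basis.coord_apply, Basis.repr_self, smul_eq_mul, Finsupp.single_apply, add_left_inj]
    split_ifs with h
    · rw [h]
    · simp
  exact LinearMap.congr_fun this b

theorem repr_mul_right_eq_zero (hm : IsMonomialBasis m q) (b : B) {w v : σ → ℕ} (h : ¬ w ≤ v) :
    m.repr (b * m w) v = 0 := by
  have : (m.coord v) ∘ₗ LinearMap.mulRight k (m w) = 0 := by
    refine m.ext fun a => ?_
    obtain ⟨u, hu⟩ := hm.mul a w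
    have : a + w ≠ v := by
      rintro rfl
      exact h le_add_self
    simp [hu, this]
  exact LinearMap.congr_fun this b

theorem exists_eq_mul_right (hm : IsMonomialBasis m q) {b : B} {w : σ → ℕ}
    (h : ∀ v, m.repr b v ≠ 0 → w ≤ v) : ∃ d, b = d * m w := by
  have : b ∈ LinearMap.range (LinearMap.mulRight k (m w)) := by
    rw [← m.linearCombination_repr b, Finsupp.linearCombination_apply]
    refine Submodule.sum_mem _ fun v hv => Submodule.smul_mem _ _ ?_
    obtain ⟨u, hu⟩ := hm.mul' (v - w) w
    rw [tsub_add_cancel_of_le (h v (Finsupp.mem_support_iff.1 hv))] at hu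
    exact ⟨(u : k) • m (v - w), by simp [hu]⟩
  obtain ⟨d, hd⟩ := this
  exact ⟨d, hd.symm⟩

/-- Exponent vectors have unique sums: some exponent of the product arises from a single pair of
monomials, so no cancellation can occur there. -/
theorem noZeroDivisors [IsDomain k] (hm : IsMonomialBasis m q) : NoZeroDivisors B := by
  refine ⟨fun {a b} hab => ?_⟩
  by_contra! h
  obtain ⟨ha, hb⟩ := h
  choose c hc using hm.mul
  obtain ⟨v, hv, w, hw, huniq⟩ := UniqueSums.uniqueAdd_of_nonempty
    (Finsupp.support_nonempty_iff.2 ((map_ne_zero_iff _ m.repr.injective).2 ha))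
    (Finsupp.support_nonempty_iff.2 ((map_ne_zero_iff _ m.repr.injective).2 hb))
  have key : m.repr (a * b) (v + w) = m.repr a v * (m.repr b w * c v w) := by
    conv_lhs => rw [← m.linearCombination_repr a, ← m.linearCombination_repr b,
      Finsupp.linearCombination_apply, Finsupp.linearCombination_apply, Finsupp.sum, Finsupp.sum,
      Finset.sum_mul_sum]
    simp only [map_sum, Finsupp.coe_finsetSum, Finset.sum_apply, smul_mul_smul_comm, hc, smul_smul,
      map_smul, Basis.repr_self, Finsupp.smul_single, smul_eq_mul, mul_one]
    rw [Finset.sum_eq_single v, Finset.sum_eq_single w]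
    · simp [mul_assoc]
    · intro w' hw' hne
      refine Finsupp.single_eq_of_ne ?_
      intro h
      exact hne (huniq hv hw' h.symm).2
    · intro h; exact absurd hw h
    · intro v' hv' hne
      refine Finset.sum_eq_zero fun w' hw' => Finsupp.single_eq_of_ne ?_
      intro h
      exact hne (huniq hv' hw' h.symm).1
    · intro h; exact absurd hv h
  rw [hab, map_zero, Finsupp.zero_apply] at key
  exact mul_ne_zero (Finsupp.mem_support_iff.1 hv)
    (mul_ne_zero (Finsupp.mem_support_iff.1 hw) (c v w).ne_zero) key.symm

theorem mem_center_of_forall_commute (hm : IsMonomialBasis m q) {z : B}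
    (h : ∀ i, m (Pi.single i 1) * z = z * m (Pi.single i 1)) : z ∈ Subring.center B := by
  have hmono : ∀ a : σ → ℕ, m a * z = z * m a := by
    intro a
    induction hn : ∑ i, a i using Nat.strong_induction_on generalizing a with
    | _ N ih =>
      by_cases ha : a = 0
      · rw [ha, hm.one, one_mul, mul_one]
      · obtain ⟨i, hi⟩ := Function.ne_iff.1 ha
        have hle : Pi.single i 1 ≤ a := by
          intro j
          rcases eq_or_ne j i with rfl | hj
          · simpa using Nat.one_le_iff_ne_zero.2 hi
          · simp [hj]
        obtain ⟨u, hu⟩ := hm.mul' (Pi.single i 1) (a - Pi.single i 1)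
        rw [add_tsub_cancel_of_le hle] at hu
        have hlt : ∑ j, (a - Pi.single i 1 : σ → ℕ) j < N := by
          rw [← hn]
          refine Finset.sum_lt_sum (fun j _ => Nat.sub_le _ _) ⟨i, Finset.mem_univ _, ?_⟩
          have : a i ≠ 0 := hi
          simp only [Pi.sub_apply, Pi.single_eq_same]
          omega
        have hcomm := ih _ hlt _ rfl
        rw [hu, smul_mul_assoc, mul_assoc, hcomm, ← mul_assoc, h i, mul_smul_comm, mul_assoc]
  rw [Subring.mem_center_iff]
  intro g
  have : LinearMap.mulRight k z = LinearMap.mulLeft k z := m.ext hmono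
  exact LinearMap.congr_fun this g

theorem mem_center (hm : IsMonomialBasis m q) {a : σ → ℕ} (h : commChar q a = 1) :
    m a ∈ Subring.center B :=
  hm.mem_center_of_forall_commute fun i => by rw [hm.comm, h]; simp

/-- Compare the coefficients of `x_i z = z x_i` at the exponent `a + e_i`. -/
theorem commChar_eq_one_of_mem_center [IsDomain k] (hm : IsMonomialBasis m q) {z : B}
    (hz : z ∈ Subring.center B) {a : σ → ℕ} (ha : m.repr z a ≠ 0) : commChar q a = 1 := by
  have := hm.noZeroDivisors
  ext i
  have hlin : ∀ b : B, m.repr (m (Pi.single i 1) * b) (a + Pi.single i 1) =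
      commChar q a i * m.repr (b * m (Pi.single i 1)) (a + Pi.single i 1) := by
    intro b
    have : (m.coord (a + Pi.single i 1)) ∘ₗ LinearMap.mulLeft k (m (Pi.single i 1)) =
        ((commChar q a i : kˣ) : k) •
          ((m.coord (a + Pi.single i 1)) ∘ₗ LinearMap.mulRight k (m (Pi.single i 1))) := by
      refine m.ext fun v => ?_
      obtain ⟨u, hu⟩ := hm.mul v (Pi.single i 1)
      simp only [LinearMap.comp_apply, LinearMap.mulLeft_apply, LinearMap.smul_apply,
        LinearMap.mulRight_apply, hm.comm, hu, map_smul, Basis.coord_apply, Basis.repr_self,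
        smul_eq_mul, Finsupp.single_apply, add_left_inj]
      split_ifs with h
      · rw [h]
      · simp
    exact LinearMap.congr_fun this b
  obtain ⟨u, hu⟩ := hm.repr_mul_right a (Pi.single i 1)
  have h1 := hlin z
  rw [Subring.mem_center_iff.1 hz, hu] at h1
  have h2 : (u : k) * m.repr z a ≠ 0 := mul_ne_zero u.ne_zero ha
  simpa using mul_right_cancel₀ h2 ((one_mul _).trans h1).symm

/-! #### Isotypic components -/

open Classical in
/-- The projection onto the span of the monomials with commutation character `γ`. -/
noncomputable def component (m : Basis (σ → ℕ) k B) (q : σ → σ → kˣ) (γ : σ → kˣ) : B →ₗ[k] B :=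
  m.constr k fun a => if commChar q a = γ then m a else 0

omit [DecidableEq σ] in
open Classical in
theorem component_self (γ : σ → kˣ) (a : σ → ℕ) :
    component m q γ (m a) = if commChar q a = γ then m a else 0 := by
  rw [component, Basis.constr_basis]

omit [DecidableEq σ] in
open Classical in
theorem exists_sum_component (b : B) :
    ∃ S : Finset (σ → kˣ), (∀ γ ∈ S, ∃ a, commChar q a = γ) ∧ b = ∑ γ ∈ S, component m q γ b := by
  refine ⟨(m.repr b).support.image (commChar q), ?_, ?_⟩
  · intro γ hγ
    obtain ⟨a, _, rfl⟩ := Finset.mem_image.1 hγ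
    exact ⟨a, rfl⟩
  · conv_lhs => rw [← m.linearCombination_repr b, Finsupp.linearCombination_apply, Finsupp.sum]
    have : ∀ γ, component m q γ b =
        ∑ a ∈ (m.repr b).support, if commChar q a = γ then m.repr b a • m a else 0 := by
      intro γ
      conv_lhs => rw [← m.linearCombination_repr b, Finsupp.linearCombination_apply, Finsupp.sum]
      simp only [map_sum, map_smul, component_self, smul_ite, smul_zero]
    simp only [this]
    rw [Finset.sum_comm]
    refine Finset.sum_congr rfl fun a ha => ?_
    rw [Finset.sum_ite_eq, if_pos (Finset.mem_image_of_mem _ ha)]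

theorem component_mul_right (hm : IsMonomialBasis m q) (γ : σ → kˣ) (b : B) (w : σ → ℕ) :
    component m q (γ * commChar q w) (b * m w) = component m q γ b * m w := by
  have : component m q (γ * commChar q w) ∘ₗ LinearMap.mulRight k (m w) =
      LinearMap.mulRight k (m w) ∘ₗ component m q γ := by
    refine m.ext fun a => ?_
    obtain ⟨u, hu⟩ := hm.mul a w
    have hiff : commChar q (a + w) = γ * commChar q w ↔ commChar q a = γ := by
      rw [commChar_add, mul_left_inj]
    simp only [LinearMap.comp_apply, LinearMap.mulRight_apply, hu, map_smul, component_self]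
    by_cases h : commChar q a = γ
    · rw [if_pos h, if_pos (hiff.2 h), hu]
    · rw [if_neg h, if_neg (mt hiff.1 h), smul_zero, zero_mul]
  exact LinearMap.congr_fun this b

/-- The projection to the centre is a trace form. If `m v * m w` is central it commutes with `m v`,
and cancelling `m v` gives `m v * m w = m w * m v`; otherwise both projections vanish. -/
theorem component_one_mul_comm [IsDomain k] (hm : IsMonomialBasis m q) (a b : B) :
    component m q 1 (a * b) = component m q 1 (b * a) := by
  have := hm.noZeroDivisors
  have : LinearMap.compr₂ (LinearMap.mul k B) (component m q 1) =
      LinearMap.compr₂ (LinearMap.mul k B).flip (component m q 1) := by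
    refine m.ext fun v => m.ext fun w => ?_
    simp only [LinearMap.compr₂_apply, LinearMap.mul_apply', LinearMap.flip_apply]
    by_cases h : commChar q (v + w) = 1
    · congr 1
      obtain ⟨u, hu⟩ := hm.mul v w
      have hc := Subring.mem_center_iff.1 (hm.mem_center h) (m v)
      refine mul_left_cancel₀ (m.ne_zero v) ?_
      rw [hu, mul_smul_comm, hc, ← smul_mul_assoc, ← hu, mul_assoc]
    · obtain ⟨u, hu⟩ := hm.mul v w
      obtain ⟨u', hu'⟩ := hm.mul w v
      rw [hu, hu', add_comm w v]
      simp [component_self, h]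
  exact LinearMap.congr_fun (LinearMap.congr_fun this a) b

theorem component_one_of_mem_center [IsDomain k] (hm : IsMonomialBasis m q) {z : B}
    (hz : z ∈ Subring.center B) : component m q 1 z = z := by
  conv_lhs => rw [← m.linearCombination_repr z, Finsupp.linearCombination_apply, Finsupp.sum]
  conv_rhs => rw [← m.linearCombination_repr z, Finsupp.linearCombination_apply, Finsupp.sum]
  rw [map_sum]
  refine Finset.sum_congr rfl fun a ha => ?_
  rw [map_smul, component_self,
    if_pos (hm.commChar_eq_one_of_mem_center hz (Finsupp.mem_support_iff.1 ha))]

theorem component_center_mul [IsDomain k] (hm : IsMonomialBasis m q) {z : B}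
    (hz : z ∈ Subring.center B) (γ : σ → kˣ) (b : B) :
    component m q γ (z * b) = z * component m q γ b := by
  have : component m q γ ∘ₗ LinearMap.mulLeft k z =
      LinearMap.mulLeft k z ∘ₗ component m q γ := by
    refine m.ext fun a => ?_
    have h := hm.component_mul_right (γ * (commChar q a)⁻¹) z a
    rw [inv_mul_cancel_right] at h
    simp only [LinearMap.comp_apply, LinearMap.mulLeft_apply, h, component_self]
    split_ifs with h'
    · rw [← h', mul_inv_cancel, hm.component_one_of_mem_center hz]
    · conv_lhs => rw [← m.linearCombination_repr z, Finsupp.linearCombination_apply, Finsupp.sum]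
      rw [map_sum, Finset.sum_mul, mul_zero]
      refine Finset.sum_eq_zero fun v hv => ?_
      rw [map_smul, component_self, if_neg, smul_zero, zero_mul]
      rw [hm.commChar_eq_one_of_mem_center hz (Finsupp.mem_support_iff.1 hv)]
      intro h1
      exact h' (mul_inv_eq_one.1 h1.symm).symm
  exact LinearMap.congr_fun this b

theorem component_one_eq_zero_of_mem_traceless [IsDomain k] (hm : IsMonomialBasis m q) {x : B}
    (hx : x ∈ traceless B) : component m q 1 x = 0 := by
  have := hm.noZeroDivisors
  obtain ⟨c, hc, hc0, h⟩ := hx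
  have key : component m q 1 (c * x) = 0 := by
    refine AddSubgroup.closure_induction (p := fun x _ => component m q 1 x = 0)
      ?_ ?_ ?_ ?_ h
    · rintro _ ⟨a, b, rfl⟩
      rw [map_sub, hm.component_one_mul_comm, sub_self]
    · simp
    · intro x y _ _ hx hy
      rw [map_add, hx, hy, add_zero]
    · intro x _ hx
      rw [map_neg, hx, neg_zero]
  rw [hm.component_center_mul hc] at key
  exact (mul_eq_zero.1 key).resolve_left hc0

end IsMonomialBasis

/-! ### Periods of the commutation character -/

section Period

variable {G σ : Type*} [CommGroup G] [Fintype σ] (q : σ → σ → G)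

/-- The least positive exponent of the generator `s` in a central monomial. -/
noncomputable def period (s : σ) : ℕ :=
  sInf {g | 0 < g ∧ ∃ v : σ → ℕ, commChar q v = 1 ∧ v s = g}

variable {q} {l : ℕ}

theorem commChar_nsmul_eq_one (hq : ∀ i j, q i j ^ l = 1) (v : σ → ℕ) :
    commChar q (l • v) = 1 := by
  rw [commChar_nsmul]
  ext i
  simp only [commChar, Pi.pow_apply, Pi.one_apply, ← Finset.prod_pow]
  refine Finset.prod_eq_one fun j _ => ?_
  rw [pow_right_comm, hq, one_pow]

theorem period_le {v : σ → ℕ} (hv : commChar q v = 1) {s : σ} (hs : 0 < v s) :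
    period q s ≤ v s :=
  Nat.sInf_le ⟨hs, v, hv, rfl⟩

theorem period_spec (hl : 0 < l) (hq : ∀ i j, q i j ^ l = 1) (s : σ) :
    0 < period q s ∧ ∃ v : σ → ℕ, commChar q v = 1 ∧ v s = period q s :=
  Nat.sInf_mem (s := {g | 0 < g ∧ ∃ v : σ → ℕ, commChar q v = 1 ∧ v s = g})
    ⟨l, hl, l • 1, commChar_nsmul_eq_one hq _, by simp⟩

theorem exists_commChar_eq_apply_eq_mod [DecidableEq σ] (hl : 0 < l) (hq : ∀ i j, q i j ^ l = 1)
    (w : σ → ℕ) (s : σ) :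
    ∃ w' : σ → ℕ, commChar q w' = commChar q w ∧ w' s = w s % period q s := by
  obtain ⟨-, v, hv, hvs⟩ := period_spec hl hq s
  obtain ⟨t, rfl⟩ : ∃ t, l = t + 1 := ⟨l - 1, by omega⟩
  set g := period q s
  -- Subtracting `v` is replaced by adding `l - 1` copies of it. The exponent at `s` then exceeds `w
  -- s % g` by a multiple of `l`, which can be dropped without changing the character.
  refine ⟨Function.update (w + (w s / g * t) • v) s (w s % g), ?_, by simp⟩
  have h : Function.update (w + (w s / g * t) • v) s (w s % g) +
      (t + 1) • Pi.single s (w s / g * g) = w + (w s / g * t) • v := by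
    ext j
    rcases eq_or_ne j s with rfl | hj
    · simp only [Pi.add_apply, Function.update_self, Pi.smul_apply, Pi.single_eq_same, smul_eq_mul,
        hvs]
      have := Nat.mod_add_div' (w j) g
      nlinarith
    · simp [hj]
  have := congrArg (commChar q) h
  rwa [commChar_add, commChar_nsmul_eq_one hq, mul_one, commChar_add, commChar_nsmul q _ v, hv,
    one_pow, mul_one] at this

theorem period_dvd [DecidableEq σ] (hl : 0 < l) (hq : ∀ i j, q i j ^ l = 1) {v : σ → ℕ}
    (hv : commChar q v = 1) (s : σ) : period q s ∣ v s := by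
  obtain ⟨w, hw, hws⟩ := exists_commChar_eq_apply_eq_mod hl hq v s
  have hpos := (period_spec hl hq s).1
  have hlt := Nat.mod_lt (v s) hpos
  refine Nat.dvd_of_mod_eq_zero ?_
  by_contra hne
  have := period_le (hw.trans hv) (s := s) (by omega)
  omega

end Period

/-! ### The different of a monomial ring is generated by a monomial. -/

namespace IsMonomialBasis

variable {k B σ : Type*} [CommRing k] [IsDomain k] [Ring B] [Algebra k B] [Fintype σ]
  [DecidableEq σ] {m : Basis (σ → ℕ) k B} {q : σ → σ → kˣ} {l : ℕ}

theorem self_eq_one (hm : IsMonomialBasis m q) (i : σ) : q i i = 1 := by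
  have h := hm.comm i (Pi.single i 1)
  rw [commChar_single, pow_one] at h
  obtain ⟨u, hu⟩ := hm.mul (Pi.single i 1) (Pi.single i 1)
  have h2 := congrArg (fun x => m.repr x (Pi.single i 1 + Pi.single i 1)) h
  simp only [hu, map_smul, Basis.repr_self, Finsupp.smul_single, smul_eq_mul, mul_one,
    Finsupp.single_eq_same] at h2
  have : (1 : k) * u = q i i * u := by rw [one_mul]; exact h2
  exact Units.ext (mul_right_cancel₀ u.ne_zero this).symm

/-- If the character of `a` is nontrivial at `i`, then `[x_i, m b]` is a nonzero scalar times `m b *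
x_i`. Taking `b + e_i = l • 1 + a` makes this a central multiple of `m a`; the shift by `l • 1`
keeps `b` nonnegative. -/
theorem mem_traceless_of_commChar_ne_one (hm : IsMonomialBasis m q) (hl : 0 < l)
    (hq : ∀ i j, q i j ^ l = 1) {a : σ → ℕ} (ha : commChar q a ≠ 1) (r : k) :
    r • m a ∈ traceless B := by
  obtain ⟨i, hi⟩ := Function.ne_iff.1 ha
  have := hm.noZeroDivisors
  have hcL : commChar q (l • 1) = 1 := commChar_nsmul_eq_one hq 1
  have hcen := hm.mem_center hcL
  set b : σ → ℕ := a + l • 1 - Pi.single i 1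
  have hb : b + Pi.single i 1 = l • 1 + a := by
    rw [add_comm (l • 1) a]
    refine tsub_add_cancel_of_le fun j => ?_
    rcases eq_or_ne j i with rfl | hj
    · simp; omega
    · simp [hj]
  have hbi : commChar q b i = commChar q a i := by
    have h := congrFun (congrArg (commChar q) hb) i
    rw [commChar_add, commChar_add, hcL, one_mul, Pi.mul_apply, commChar_single, hm.self_eq_one,
      one_pow, mul_one] at h
    exact h
  obtain ⟨u, hu⟩ := hm.mul b (Pi.single i 1)
  obtain ⟨u', hu'⟩ := hm.mul' (l • 1) a
  rw [hb, hu', smul_smul] at hu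
  set c : k := ((commChar q a i : kˣ) : k) - 1
  have := m.isTorsionFree
  have hc : c ≠ 0 := by
    rw [Ne, sub_eq_zero]
    intro h
    exact hi (Units.ext h)
  refine ⟨(c * (u * u')) • m (l • 1), ?_, ?_, ?_⟩
  · rw [Subring.mem_center_iff] at hcen ⊢
    intro g
    rw [mul_smul_comm, hcen, smul_mul_assoc]
  · refine smul_ne_zero (mul_ne_zero hc (mul_ne_zero u.ne_zero u'.ne_zero)) (m.ne_zero _)
  · refine AddSubgroup.subset_closure ⟨m (Pi.single i 1), r • m b, ?_⟩
    rw [mul_smul_comm, mul_smul_comm, hm.comm, hbi, smul_mul_assoc, smul_mul_assoc r, hu,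
      smul_smul, smul_smul, smul_smul, smul_smul, ← sub_smul]
    congr 1
    ring

/-- The exponent vector of the generator of the different. -/
noncomputable def differentExponent (q : σ → σ → kˣ) : σ → ℕ := fun s => period q s - 1

theorem differentMonomial_mem_ringDifferent (hm : IsMonomialBasis m q) (hl : 0 < l)
    (hq : ∀ i j, q i j ^ l = 1) : m (differentExponent q) ∈ ringDifferent B := by
  have := hm.noZeroDivisors
  intro z hz hz0 b hb
  set e := differentExponent q
  suffices h : ∀ γ : σ → kˣ, (∃ a, commChar q a = γ) → ∃ d, m e * component m q γ b = z * d by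
    obtain ⟨S, hS, hbS⟩ := exists_sum_component (m := m) (q := q) b
    have : m e * b ∈ LinearMap.range (LinearMap.mulLeft k z) := by
      rw [hbS, Finset.mul_sum]
      refine Submodule.sum_mem _ fun γ hγ => ?_
      obtain ⟨d, hd⟩ := h γ (hS γ hγ)
      exact ⟨d, hd.symm⟩
    obtain ⟨d, hd⟩ := this
    exact ⟨d, hd.symm⟩
  rintro γ ⟨a, ha⟩
  -- Multiplying by `m w` moves the `γ`-component into the centre, where trace divisibility becomes
  -- actual divisibility by `z`.
  have hdiv : ∀ w, commChar q w = γ⁻¹ → ∃ ζ ∈ Subring.center B,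
      component m q γ b * m w = z * ζ := by
    intro w hw
    obtain ⟨ζ, hζ, h⟩ := hb (m w)
    refine ⟨ζ, hζ, ?_⟩
    have h0 := hm.component_one_eq_zero_of_mem_traceless h
    rw [map_sub, hm.component_center_mul hz, hm.component_one_of_mem_center hζ, sub_eq_zero] at h0
    rw [← h0, ← hm.component_mul_right, hw, mul_inv_cancel]
  obtain ⟨w, hw⟩ : ∃ w, commChar q w = γ⁻¹ := by
    refine ⟨(l - 1) • a, ?_⟩
    have h1 := commChar_nsmul_eq_one hq a
    obtain ⟨t, rfl⟩ : ∃ t, l = t + 1 := ⟨l - 1, by omega⟩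
    rw [add_smul, one_smul, commChar_add, ha] at h1
    exact eq_inv_of_mul_eq_one_left h1
  obtain ⟨ζ, hζ, hζw⟩ := hdiv w hw
  -- For each coordinate `s`, compare `w` with a `w'` of the same character and `w' s = w s % period
  -- q s`. Since `ζ * m w'` is a unit multiple of `ζ' * m w`, one gets `w ≤ v + w'`, and `w' s` is
  -- at most `e s`.
  have hle : ∀ v, m.repr ζ v ≠ 0 → w ≤ v + e := by
    intro v hv s
    obtain ⟨w', hw', hws⟩ := exists_commChar_eq_apply_eq_mod hl hq w s
    obtain ⟨ζ', hζ', hζw'⟩ := hdiv w' (hw'.trans hw)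
    have heq : ∃ u : kˣ, ζ * m w' = (u : k) • (ζ' * m w) := by
      obtain ⟨u, hu⟩ := hm.mul w w'
      obtain ⟨u', hu'⟩ := hm.mul' w' w
      refine ⟨u * u', mul_left_cancel₀ hz0 ?_⟩
      rw [← mul_assoc, ← hζw, mul_assoc, hu, add_comm, hu', mul_smul_comm, mul_smul_comm,
        mul_smul_comm, ← mul_assoc, hζw', mul_assoc, smul_smul, Units.val_mul]
    obtain ⟨u, hu⟩ := heq
    have hne : m.repr (ζ' * m w) (v + w') ≠ 0 := by
      intro h
      obtain ⟨u', hu'⟩ := hm.repr_mul_right v w'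
      have h1 := hu' ζ
      rw [hu, map_smul, Finsupp.smul_apply, h, smul_zero] at h1
      exact mul_ne_zero u'.ne_zero hv h1.symm
    have hle' : w ≤ v + w' := by
      by_contra h
      exact hne (hm.repr_mul_right_eq_zero ζ' h)
    have h1 := hle' s
    have h2 := Nat.mod_lt (w s) (period_spec hl hq s).1
    simp only [Pi.add_apply] at h1 ⊢
    have h3 : e s = period q s - 1 := rfl
    omega
  obtain ⟨d, hd⟩ : ∃ d, ζ * m e = d * m w := by
    refine hm.exists_eq_mul_right fun v hv => ?_
    have hev : e ≤ v := by
      by_contra h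
      exact hv (hm.repr_mul_right_eq_zero ζ h)
    obtain ⟨u, hu⟩ := hm.repr_mul_right (v - e) e
    have h1 := hu ζ
    rw [tsub_add_cancel_of_le hev] at h1
    have := hle (v - e) fun h0 => hv (by rw [h1, h0, mul_zero])
    rwa [tsub_add_cancel_of_le hev] at this
  refine ⟨d, mul_right_cancel₀ (m.ne_zero w) ?_⟩
  rw [mul_assoc, hζw, ← mul_assoc, Subring.mem_center_iff.1 hz, mul_assoc,
    Subring.mem_center_iff.1 hζ, hd, mul_assoc]

/-- One test pair suffices: `z = m (l • 1)` and `b = m (l • 1 - e)`, whose quotient is, up to a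
unit, the inverse of `m e`. -/
theorem exists_eq_mul_differentMonomial (hm : IsMonomialBasis m q) (hl : 0 < l)
    (hq : ∀ i j, q i j ^ l = 1) {a : B} (ha : a ∈ ringDifferent B) :
    ∃ d, a = d * m (differentExponent q) := by
  have := hm.noZeroDivisors
  have := hm.nontrivial
  set e := differentExponent q
  have hcL : commChar q (l • 1) = 1 := commChar_nsmul_eq_one hq 1
  have hcen := hm.mem_center hcL
  have hpl : ∀ s, period q s ∣ l := fun s => by simpa using period_dvd hl hq hcL s
  have heL : e ≤ l • 1 := by
    intro s
    have h := Nat.le_of_dvd hl (hpl s)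
    have h' : e s = period q s - 1 := rfl
    simp only [Pi.smul_apply, Pi.one_apply, smul_eq_mul, mul_one]
    omega
  have htr : TraceDvd (m (l • 1)) (m (l • 1 - e)) := by
    intro y
    rw [← m.linearCombination_repr y, Finsupp.linearCombination_apply, Finsupp.sum]
    refine Finset.sum_induction _ (fun y => ∃ ζ ∈ Subring.center B,
      m (l • 1 - e) * y - m (l • 1) * ζ ∈ traceless B) ?_ ?_ ?_
    · rintro y y' ⟨ζ, hζ, h⟩ ⟨ζ', hζ', h'⟩
      refine ⟨ζ + ζ', add_mem hζ hζ', ?_⟩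
      convert add_mem_traceless h h' using 1
      noncomm_ring
    · exact ⟨0, zero_mem _, by simpa using zero_mem_traceless⟩
    · intro w _
      obtain ⟨u, hu⟩ := hm.mul (l • 1 - e) w
      by_cases hc : commChar q (l • 1 - e + w) = 1
      -- The period divides both `l` and `l - (period q s - 1) + w s`, hence `w s + 1`, which forces
      -- `w s ≥ period q s - 1`.
      · have hew : e ≤ w := by
          intro s
          change e s ≤ w s
          have h1 := period_dvd hl hq hc s
          have h2 : e s = period q s - 1 := rfl
          have h3 := (period_spec hl hq s).1
          have h4 := Nat.le_of_dvd hl (hpl s)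
          simp only [Pi.add_apply, Pi.sub_apply, Pi.smul_apply, Pi.one_apply, smul_eq_mul,
            mul_one, h2] at h1
          rw [h2]
          by_contra! hlt
          have h5 : l - (period q s - 1) + w s = l - period q s + (1 + w s) := by omega
          rw [h5] at h1
          have h6 := (Nat.dvd_add_right (Nat.dvd_sub (hpl s) dvd_rfl)).1 h1
          have := Nat.le_of_dvd (by omega) h6
          omega
        have hsum : l • 1 - e + w = l • 1 + (w - e) := by
          ext s
          have h1 : e s ≤ w s := hew s
          have h2 : e s ≤ (l • 1 : σ → ℕ) s := heL s
          simp only [Pi.add_apply, Pi.sub_apply, Pi.smul_apply, Pi.one_apply, smul_eq_mul,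
            mul_one] at h2 ⊢
          omega
        obtain ⟨u', hu'⟩ := hm.mul' (l • 1) (w - e)
        have hcw : commChar q (w - e) = 1 := by
          rwa [hsum, commChar_add, hcL, one_mul] at hc
        refine ⟨(m.repr y w * (u * u')) • m (w - e), ?_, ?_⟩
        · have := Subring.mem_center_iff.1 (hm.mem_center hcw)
          rw [Subring.mem_center_iff]
          intro g
          rw [mul_smul_comm, this, smul_mul_assoc]
        · rw [mul_smul_comm, hu, hsum, hu', mul_smul_comm, smul_smul, smul_smul, mul_assoc,
            sub_self]
          exact zero_mem_traceless
      · refine ⟨0, zero_mem _, ?_⟩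
        rw [mul_zero, sub_zero, mul_smul_comm, hu, smul_smul]
        exact hm.mem_traceless_of_commChar_ne_one hl hq hc _
  obtain ⟨d, hd⟩ := ha _ hcen (m.ne_zero _) _ htr
  obtain ⟨u, hu⟩ := hm.mul' e (l • 1 - e)
  rw [add_tsub_cancel_of_le heL] at hu
  refine ⟨(u : k) • d, mul_right_cancel₀ (m.ne_zero (l • 1 - e)) ?_⟩
  rw [hd, ← Subring.mem_center_iff.1 hcen, hu, mul_smul_comm, smul_mul_assoc, smul_mul_assoc,
    mul_assoc]

end IsMonomialBasis

/-! ### Adjoining a central variable -/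

section PolynomialBasis

open Polynomial

variable {k B σ : Type*} [CommRing k] [Ring B] [Algebra k B]

/-- The commutation parameters after adjoining a central variable `none`. -/
def optionParam {G : Type*} [One G] (q : σ → σ → G) : Option σ → Option σ → G
  | some i, some j => q i j
  | _, _ => 1

/-- The basis `m a * X ^ r` of `B[X]`. -/
noncomputable def polynomialBasis (m : Basis (σ → ℕ) k B) : Basis (Option σ → ℕ) k B[X] :=
  (m.smulTower (Polynomial.basisMonomials B)).reindex
    ((Equiv.prodComm _ _).trans
      (Equiv.piOptionEquivProd (α := σ) (β := fun _ => ℕ)).symm)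

theorem polynomialBasis_apply (m : Basis (σ → ℕ) k B) (a : Option σ → ℕ) :
    polynomialBasis m a = monomial (a none) (m fun i => a (some i)) := by
  simp [polynomialBasis, Basis.smulTower_apply, Equiv.piOptionEquivProd, smul_monomial]

variable [Fintype σ]

theorem commChar_optionParam_some {G : Type*} [CommGroup G] (q : σ → σ → G) (a : Option σ → ℕ)
    (i : σ) : commChar (optionParam q) a (some i) = commChar q (fun i => a (some i)) i := by
  simp [commChar, Fintype.prod_option, optionParam]

theorem commChar_optionParam_none {G : Type*} [CommGroup G] (q : σ → σ → G) (a : Option σ → ℕ) :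
    commChar (optionParam q) a none = 1 := by
  simp [commChar, optionParam]

theorem commChar_eq_one_of_optionParam {G : Type*} [CommGroup G] {q : σ → σ → G}
    {a : Option σ → ℕ} (ha : commChar (optionParam q) a = 1) :
    commChar q (fun i => a (some i)) = 1 := by
  ext i
  rw [← commChar_optionParam_some, ha]
  rfl

variable [DecidableEq σ] {m : Basis (σ → ℕ) k B} {q : σ → σ → kˣ}

theorem IsMonomialBasis.polynomial (hm : IsMonomialBasis m q) :
    IsMonomialBasis (polynomialBasis m) (optionParam q) where
  one := by
    rw [polynomialBasis_apply]
    exact (congrArg (monomial 0) hm.one).trans rfl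
  mul a b := by
    obtain ⟨u, hu⟩ := hm.mul (fun i => a (some i)) (fun i => b (some i))
    refine ⟨u, ?_⟩
    rw [polynomialBasis_apply, polynomialBasis_apply, polynomialBasis_apply, monomial_mul_monomial,
      hu, smul_monomial]
    rfl
  comm i a := by
    rw [polynomialBasis_apply, polynomialBasis_apply, monomial_mul_monomial, monomial_mul_monomial,
      smul_monomial, add_comm]
    congr 1
    rcases i with _ | i
    · have : (fun i : σ => (Pi.single none 1 : Option σ → ℕ) (some i)) = 0 := by
        ext i; simp
      rw [commChar_optionParam_none, this, hm.one]
      simp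
    · have : (fun j : σ => (Pi.single (some i) 1 : Option σ → ℕ) (some j)) = Pi.single i 1 := by
        ext j; simp [Pi.single_apply]
      rw [commChar_optionParam_some, this, hm.comm]

theorem period_optionParam_none : period (optionParam q) none ≤ 1 := by
  have h : commChar (optionParam q) (Pi.single none 1) = 1 := by
    ext i
    rcases i with _ | i <;> simp [commChar_single, optionParam]
  simpa using period_le h (s := none) (by simp)

/-- A generator whose exponent in every central monomial is divisible by some fixed integer
greater than one is killed by every locally nilpotent higher derivation. -/
theorem IsMonomialBasis.higherDerivation_eq_zero [IsDomain k] (hm : IsMonomialBasis m q) {l : ℕ}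
    (hl : 0 < l) (hq : ∀ i j, q i j ^ l = 1) {s : σ}
    (hs : ∀ v : σ → ℕ, commChar q v = 1 → v s ≠ 1) {d : HigherDerivation k B}
    (hd : d.IsLocallyNilpotent) {i : ℕ} (hi : 1 ≤ i) : d.D i (m (Pi.single s 1)) = 0 := by
  have := hm.noZeroDivisors
  obtain ⟨G, -, hG⟩ := hd.automorphism
  have hM := hm.polynomial
  have hQ : ∀ i j, optionParam q i j ^ l = 1 := by
    rintro (_ | i) (_ | j) <;> simp [optionParam, hq]
  set e := IsMonomialBasis.differentExponent (optionParam q)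
  have he0 : e none = 0 := Nat.sub_eq_zero_of_le period_optionParam_none
  have hes : 1 ≤ e (some s) := by
    obtain ⟨hpos, v, hv, hvs⟩ := period_spec hl hQ (some s)
    have h1 := hs _ (commChar_eq_one_of_optionParam hv)
    change 1 ≤ period (optionParam q) (some s) - 1
    simp only [hvs] at h1
    omega
  -- The inverse of `G` also preserves the different, so the generator equals `G g` times its own
  -- image; degrees in `X` add in a domain and the generator is constant.
  obtain ⟨g, hg⟩ := hM.exists_eq_mul_differentMonomial hl hQ
    (map_mem_ringDifferent G.symm.toRingEquiv (hM.differentMonomial_mem_ringDifferent hl hQ))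
  have hgG : polynomialBasis m e = G g * G (polynomialBasis m e) := by
    rw [← map_mul, ← hg]
    exact (G.apply_symm_apply _).symm
  have hne : polynomialBasis m e ≠ 0 := (polynomialBasis m).ne_zero e
  have hGne : ∀ {y : B[X]}, y ≠ 0 → G y ≠ 0 := fun hy => by simpa using hy
  have hdeg : (G (polynomialBasis m e)).natDegree = 0 := by
    have h1 := congrArg natDegree hgG
    rw [natDegree_mul (fun h => hne (by rw [hgG, h, zero_mul])) (hGne hne)] at h1
    rw [polynomialBasis_apply, he0, monomial_zero_left, natDegree_C] at h1
    rw [polynomialBasis_apply, he0, monomial_zero_left]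
    omega
  -- Now `x_s` is split off as a factor of the generator.
  have hle : Pi.single s 1 ≤ fun i => e (some i) := by
    intro j
    rcases eq_or_ne j s with rfl | hj
    · simpa using hes
    · simp [hj]
  obtain ⟨u, hu⟩ := hm.mul' (Pi.single s 1) ((fun i => e (some i)) - Pi.single s 1)
  rw [add_tsub_cancel_of_le hle, ← mul_smul_comm] at hu
  have h2 : (polynomialBasis m) e = C (m (Pi.single s 1)) *
      C ((u : k) • m ((fun i => e (some i)) - Pi.single s 1)) := by
    rw [polynomialBasis_apply, he0, monomial_zero_left, hu, C_mul]
  rw [h2] at hne hdeg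
  rw [map_mul, natDegree_mul (hGne (left_ne_zero_of_mul hne))
    (hGne (right_ne_zero_of_mul hne))] at hdeg
  rw [← hG]
  exact coeff_eq_zero_of_natDegree_lt (by omega)

end PolynomialBasis

/-! ### The monomial basis of a skew polynomial ring -/

namespace SkewPolynomialRing

/-! ### Presentation and universal property. -/

section Lift

variable {k : Type*} [CommRing k] {n : ℕ} {p : Fin n → Fin n → kˣ}

theorem x_mul_x (i j : Fin n) (h : i < j) :
    x k p j * x k p i = (p i j : k) • (x k p i * x k p j) := by
  have := RingQuot.mkAlgHom_rel k (Rel.comm (k := k) (p := p) i j h)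
  rw [map_mul, map_smul, map_mul] at this
  exact this

/-- The universal property. -/
noncomputable def lift {B : Type*} [Ring B] [Algebra k B] (f : Fin n → B)
    (hf : ∀ i j, i < j → f j * f i = (p i j : k) • (f i * f j)) :
    SkewPolynomialRing k p →ₐ[k] B :=
  RingQuot.liftAlgHom k ⟨FreeAlgebra.lift k f, by
    rintro _ _ ⟨i, j, h⟩
    simp [hf i j h]⟩

theorem lift_x {B : Type*} [Ring B] [Algebra k B] (f : Fin n → B)
    (hf : ∀ i j, i < j → f j * f i = (p i j : k) • (f i * f j)) (i : Fin n) :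
    lift f hf (x k p i) = f i := by
  have := RingQuot.liftAlgHom_mkAlgHom_apply k (s := Rel k p) (FreeAlgebra.lift k f) (by
    rintro _ _ ⟨i, j, h⟩
    simp [hf i j h]) (FreeAlgebra.ι k i)
  rw [FreeAlgebra.lift_ι_apply] at this
  exact this

theorem adjoin_range_x : Algebra.adjoin k (Set.range (x k p)) = ⊤ := by
  have h : Set.range (x k p) =
      RingQuot.mkAlgHom k (Rel k p) '' Set.range (FreeAlgebra.ι k) := by
    rw [← Set.range_comp]; rfl
  have h2 : Algebra.adjoin k (RingQuot.mkAlgHom k (Rel k p) '' Set.range (FreeAlgebra.ι k)) = ⊤ := by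
    rw [← AlgHom.map_adjoin, FreeAlgebra.adjoin_range_ι, Algebra.map_top, AlgHom.range_eq_top]
    exact RingQuot.mkAlgHom_surjective k _
  rw [h]
  exact h2

theorem algHom_ext {B : Type*} [Ring B] [Algebra k B] {f g : SkewPolynomialRing k p →ₐ[k] B}
    (h : ∀ i, f (x k p i) = g (x k p i)) : f = g := by
  refine AlgHom.ext_of_adjoin_eq_top adjoin_range_x ?_
  rintro _ ⟨i, rfl⟩
  exact h i

end Lift

variable {k : Type*} [CommRing k] {n : ℕ} {p : Fin n → Fin n → kˣ}

theorem x_comm (hp : IsMultAntisymm p) (i j : Fin n) :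
    x k p i * x k p j = (p j i : k) • (x k p j * x k p i) := by
  rcases lt_trichotomy i j with h | rfl | h
  · rw [x_mul_x i j h, smul_smul, hp.inv i j, Units.inv_mul, one_smul]
  · rw [hp.diag, Units.val_one, one_smul]
  · exact x_mul_x j i h

variable (k p)

/-- The ordered monomial with exponents `a`. -/
noncomputable def mono (a : Fin n → ℕ) : SkewPolynomialRing k p :=
  ((List.finRange n).map fun i => x k p i ^ a i).prod

variable {k p}

theorem x_mul_x_pow (hp : IsMultAntisymm p) (i j : Fin n) (r : ℕ) :
    x k p i * x k p j ^ r = ((p j i ^ r : kˣ) : k) • (x k p j ^ r * x k p i) := by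
  induction r with
  | zero => simp
  | succ r ih =>
    rw [pow_succ, ← mul_assoc, ih, smul_mul_assoc, mul_assoc, x_comm hp, mul_smul_comm, smul_smul,
      pow_succ, Units.val_mul, mul_assoc]

theorem x_mul_list_prod (hp : IsMultAntisymm p) (i : Fin n) (a : Fin n → ℕ) (l : List (Fin n)) :
    x k p i * (l.map fun j => x k p j ^ a j).prod =
      (((l.map fun j => p j i ^ a j).prod : kˣ) : k) •
        ((l.map fun j => x k p j ^ a j).prod * x k p i) := by
  induction l with
  | nil => simp
  | cons j l ih =>
    rw [List.map_cons, List.prod_cons, ← mul_assoc, x_mul_x_pow hp, smul_mul_assoc, mul_assoc, ih,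
      mul_smul_comm, smul_smul, List.map_cons, List.prod_cons, Units.val_mul, mul_assoc]

theorem x_mul_mono_comm (hp : IsMultAntisymm p) (i : Fin n) (a : Fin n → ℕ) :
    x k p i * mono k p a =
      ((commChar (fun i j => p j i) a i : kˣ) : k) • (mono k p a * x k p i) := by
  rw [mono, x_mul_list_prod hp]
  rw [commChar, Fin.prod_univ_def]

theorem x_mul_list_prod_of_mem (hp : IsMultAntisymm p) (i : Fin n) (a : Fin n → ℕ)
    {l : List (Fin n)} (hl : l.Nodup) (hi : i ∈ l) :
    ∃ u : kˣ, x k p i * (l.map fun j => x k p j ^ a j).prod =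
      (u : k) • (l.map fun j => x k p j ^ (a + Pi.single i 1 : Fin n → ℕ) j).prod := by
  induction l with
  | nil => simp at hi
  | cons j l ih =>
    rw [List.nodup_cons] at hl
    simp only [List.map_cons, List.prod_cons]
    rcases eq_or_ne i j with rfl | hij
    · refine ⟨1, ?_⟩
      have : (l.map fun j => x k p j ^ (a + Pi.single i 1 : Fin n → ℕ) j) =
          l.map fun j => x k p j ^ a j := by
        refine List.map_congr_left fun j hj => ?_
        have : j ≠ i := by rintro rfl; exact hl.1 hj
        simp [this]
      rw [this, ← mul_assoc, ← pow_succ']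
      simp
    · obtain ⟨u, hu⟩ := ih hl.2 ((List.mem_cons.1 hi).resolve_left hij)
      refine ⟨p j i ^ a j * u, ?_⟩
      rw [← mul_assoc, x_mul_x_pow hp, smul_mul_assoc, mul_assoc, hu, mul_smul_comm, smul_smul]
      simp [hij.symm]

theorem x_mul_mono (hp : IsMultAntisymm p) (i : Fin n) (a : Fin n → ℕ) :
    ∃ u : kˣ, x k p i * mono k p a = (u : k) • mono k p (a + Pi.single i 1) :=
  x_mul_list_prod_of_mem hp i a (List.nodup_finRange n) (List.mem_finRange i)

theorem x_pow_mul_mono (hp : IsMultAntisymm p) (i : Fin n) (r : ℕ) (a : Fin n → ℕ) :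
    ∃ u : kˣ, x k p i ^ r * mono k p a = (u : k) • mono k p (a + Pi.single i r) := by
  induction r with
  | zero => exact ⟨1, by simp⟩
  | succ r ih =>
    obtain ⟨u, hu⟩ := ih
    obtain ⟨u', hu'⟩ := x_mul_mono hp i (a + Pi.single i r)
    refine ⟨u * u', ?_⟩
    rw [pow_succ', mul_assoc, hu, mul_smul_comm, hu', smul_smul, add_assoc, ← Pi.single_add,
      Units.val_mul]

theorem list_prod_mul_mono {ι : Type*} (hp : IsMultAntisymm p) (f : ι → Fin n) (a : ι → ℕ)
    (b : Fin n → ℕ) (l : List ι) :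
    ∃ u : kˣ, (l.map fun j => x k p (f j) ^ a j).prod * mono k p b =
      (u : k) • mono k p ((l.map fun j => Pi.single (f j) (a j)).sum + b) := by
  induction l with
  | nil => exact ⟨1, by simp⟩
  | cons j l ih =>
    obtain ⟨u, hu⟩ := ih
    obtain ⟨u', hu'⟩ := x_pow_mul_mono hp (f j) (a j)
      ((l.map fun j => Pi.single (f j) (a j)).sum + b)
    refine ⟨u * u', ?_⟩
    rw [List.map_cons, List.prod_cons, mul_assoc, hu, mul_smul_comm, hu', smul_smul,
      List.map_cons, List.sum_cons, Units.val_mul, add_comm (_ + b), add_assoc]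

theorem mono_zero : mono k p 0 = 1 := by
  simp [mono]

theorem mono_mul_mono (hp : IsMultAntisymm p) (a b : Fin n → ℕ) :
    ∃ u : kˣ, mono k p a * mono k p b = (u : k) • mono k p (a + b) := by
  obtain ⟨u, hu⟩ := list_prod_mul_mono (k := k) hp id a b (List.finRange n)
  refine ⟨u, ?_⟩
  rw [mono]
  refine hu.trans ?_
  congr 3
  rw [← Fin.sum_univ_def]
  exact Finset.univ_sum_single a

theorem mono_single (i : Fin n) (r : ℕ) : mono k p (Pi.single i r) = x k p i ^ r := by
  have key : ∀ l : List (Fin n), l.Nodup →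
      (l.map fun j => x k p j ^ (Pi.single i r : Fin n → ℕ) j).prod =
        if i ∈ l then x k p i ^ r else 1 := by
    intro l hl
    induction l with
    | nil => simp
    | cons j l ih =>
      rw [List.nodup_cons] at hl
      rw [List.map_cons, List.prod_cons, ih hl.2]
      rcases eq_or_ne i j with rfl | hij
      · simp [hl.1]
      · simp [hij, hij.symm]
  rw [mono, key _ (List.nodup_finRange n), if_pos (List.mem_finRange i)]

/-! #### Linear independence -/

/-- Left multiplication by the generator `i` on normally ordered monomials. -/
noncomputable def mulGen (p : Fin n → Fin n → kˣ) (i : Fin n) :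
    ((Fin n → ℕ) →₀ k) →ₗ[k] ((Fin n → ℕ) →₀ k) :=
  Finsupp.linearCombination k fun b =>
    Finsupp.single (b + Pi.single i 1)
      ((∏ j, (if j < i then p j i else 1) ^ b j : kˣ) : k)

theorem mulGen_single (i : Fin n) (b : Fin n → ℕ) (r : k) :
    mulGen p i (Finsupp.single b r) = Finsupp.single (b + Pi.single i 1)
      (r * ((∏ j, (if j < i then p j i else 1) ^ b j : kˣ) : k)) := by
  rw [mulGen, Finsupp.linearCombination_single, Finsupp.smul_single, smul_eq_mul]

/-- The representation of the skew polynomial ring on normally ordered monomials. -/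
noncomputable def regularRep (p : Fin n → Fin n → kˣ) :
    SkewPolynomialRing k p →ₐ[k] Module.End k ((Fin n → ℕ) →₀ k) :=
  lift (mulGen p) fun i j h => by
    refine Finsupp.lhom_ext fun b r => ?_
    -- Applying `j'` before `i'` costs an extra `p j' i'` only when `j' < i'`, so the two orders
    -- differ by exactly `p i j`.
    have key : ∀ i' j' : Fin n, (∏ t, (if t < i' then p t i' else 1) ^ (b + Pi.single j' 1 : Fin n → ℕ) t) =
        (∏ t, (if t < i' then p t i' else 1) ^ b t) * if j' < i' then p j' i' else 1 := by
      intro i' j'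
      simp only [Pi.add_apply, pow_add, Finset.prod_mul_distrib]
      congr 1
      rw [Finset.prod_eq_single j']
      · simp
      · intro t _ ht
        simp [ht]
      · simp
    simp only [Module.End.mul_apply, LinearMap.smul_apply, mulGen_single, key, if_pos h,
      if_neg h.not_gt, Finsupp.smul_single]
    rw [add_right_comm]
    congr 1
    push_cast
    simp only [smul_eq_mul]
    ring

theorem regularRep_x_pow (i : Fin n) (r : ℕ) (b : Fin n → ℕ) (u : kˣ) :
    ∃ u' : kˣ, regularRep p (x k p i ^ r) (Finsupp.single b (u : k)) =
      Finsupp.single (Pi.single i r + b) (u' : k) := by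
  induction r with
  | zero => exact ⟨u, by simp⟩
  | succ r ih =>
    obtain ⟨u', hu'⟩ := ih
    rw [pow_succ', map_mul, Module.End.mul_apply, hu', regularRep, lift_x, mulGen_single]
    exact ⟨u' * ∏ j, (if j < i then p j i else 1) ^ (Pi.single i r + b : Fin n → ℕ) j, by
      rw [← Units.val_mul, Pi.single_add, add_right_comm]⟩

theorem regularRep_mono (a : Fin n → ℕ) :
    ∃ u : kˣ, regularRep p (mono k p a) (Finsupp.single 0 1) = Finsupp.single a (u : k) := by
  have key : ∀ l : List (Fin n), ∃ u : kˣ,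
      regularRep p (l.map fun j => x k p j ^ a j).prod (Finsupp.single 0 1) =
        Finsupp.single ((l.map fun j => Pi.single j (a j)).sum) (u : k) := by
    intro l
    induction l with
    | nil => exact ⟨1, by simp⟩
    | cons j l ih =>
      obtain ⟨u, hu⟩ := ih
      rw [List.map_cons, List.prod_cons, map_mul, Module.End.mul_apply, hu, List.map_cons,
        List.sum_cons]
      exact regularRep_x_pow _ _ _ _
  obtain ⟨u, hu⟩ := key (List.finRange n)
  refine ⟨u, hu.trans ?_⟩
  congr 1
  rw [← Fin.sum_univ_def]
  exact Finset.univ_sum_single a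

/-- In the regular representation, the monomial `a` sends the basis vector at `0` to a unit multiple
of the basis vector at `a`. -/
theorem linearIndependent_mono : LinearIndependent k (mono k p) := by
  choose u hu using regularRep_mono (k := k) (p := p)
  refine LinearIndependent.of_comp
    ((LinearMap.applyₗ (Finsupp.single 0 (1 : k))) ∘ₗ (regularRep p).toLinearMap) ?_
  have := ((Finsupp.basisSingleOne (R := k) (ι := Fin n → ℕ)).linearIndependent).units_smul u
  convert this using 1
  ext1 a
  simp [hu, Units.smul_def]

theorem span_range_mono (hp : IsMultAntisymm p) :
    Submodule.span k (Set.range (mono k p)) = ⊤ := by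
  set V := Submodule.span k (Set.range (mono k p))
  have key : ∀ y : SkewPolynomialRing k p, ∀ v ∈ V, y * v ∈ V := by
    intro y
    have hy : y ∈ Algebra.adjoin k (Set.range (x k p)) := by rw [adjoin_range_x]; trivial
    induction hy using Algebra.adjoin_induction with
    | mem y hy =>
      obtain ⟨i, rfl⟩ := hy
      intro v hv
      induction hv using Submodule.span_induction with
      | mem v hv =>
        obtain ⟨a, rfl⟩ := hv
        obtain ⟨u, hu⟩ := x_mul_mono hp i a
        rw [hu]
        exact V.smul_mem _ (Submodule.subset_span ⟨_, rfl⟩)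
      | zero => simp
      | add v w _ _ hv hw => rw [mul_add]; exact add_mem hv hw
      | smul r v _ hv => rw [mul_smul_comm]; exact V.smul_mem _ hv
    | algebraMap r =>
      intro v hv
      rw [← Algebra.smul_def]
      exact V.smul_mem _ hv
    | add y z _ _ hy hz =>
      intro v hv
      rw [add_mul]
      exact add_mem (hy v hv) (hz v hv)
    | mul y z _ _ hy hz =>
      intro v hv
      rw [mul_assoc]
      exact hy _ (hz v hv)
  rw [eq_top_iff]
  intro y _
  have h1 : (1 : SkewPolynomialRing k p) ∈ V := mono_zero (k := k) (p := p) ▸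
    Submodule.subset_span ⟨0, rfl⟩
  simpa using key y 1 h1

/-- The basis of ordered monomials. -/
noncomputable def monoBasis (hp : IsMultAntisymm p) :
    Basis (Fin n → ℕ) k (SkewPolynomialRing k p) :=
  Basis.mk linearIndependent_mono (span_range_mono hp).ge

theorem monoBasis_apply (hp : IsMultAntisymm p) (a : Fin n → ℕ) :
    monoBasis hp a = mono k p a := by
  rw [monoBasis, Basis.mk_apply]

theorem isMonomialBasis_monoBasis (hp : IsMultAntisymm p) :
    IsMonomialBasis (monoBasis hp) (fun i j => p j i) where
  one := by rw [monoBasis_apply, mono_zero]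
  mul a b := by simpa only [monoBasis_apply] using mono_mul_mono hp a b
  comm i a := by
    rw [monoBasis_apply, monoBasis_apply, mono_single, pow_one]
    exact x_mul_mono_comm hp i a

end SkewPolynomialRing

/-! ### Higher derivations from algebra maps -/

/-- The higher derivation given by the coefficients of an algebra map `A → A[t]` lifting the
identity. -/
noncomputable def HigherDerivation.ofAlgHom {k A : Type*} [CommRing k] [Ring A] [Algebra k A]
    (G : A →ₐ[k] Polynomial A) (hG : ∀ a, (G a).coeff 0 = a) : HigherDerivation k A where
  D i := ((Polynomial.lcoeff A i).restrictScalars k) ∘ₗ G.toLinearMap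
  D_zero := LinearMap.ext hG
  leibniz r a b := by
    simp only [LinearMap.comp_apply, AlgHom.toLinearMap_apply, LinearMap.restrictScalars_apply,
      Polynomial.lcoeff_apply, map_mul, Polynomial.coeff_mul]
    exact Finset.Nat.sum_antidiagonal_eq_sum_range_succ
      (fun i j => (G a).coeff i * (G b).coeff j) r

theorem HigherDerivation.ofAlgHom_D {k A : Type*} [CommRing k] [Ring A] [Algebra k A]
    (G : A →ₐ[k] Polynomial A) (hG : ∀ a, (G a).coeff 0 = a) (i : ℕ) (a : A) :
    (ofAlgHom G hG).D i a = (G a).coeff i :=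
  rfl

namespace SkewPolynomialRing

open Polynomial

/-! ### The automorphisms `x_s ↦ x_s + y t` and their higher derivations. -/

section Shift

variable {k : Type*} [CommRing k] {n : ℕ} {p : Fin n → Fin n → kˣ}

theorem mono_mem_adjoin {S : Set (Fin n)} {a : Fin n → ℕ} (ha : ∀ i, a i ≠ 0 → i ∈ S) :
    mono k p a ∈ Algebra.adjoin k (x k p '' S) := by
  refine Subalgebra.list_prod_mem _ fun y hy => ?_
  obtain ⟨i, -, rfl⟩ := List.mem_map.1 hy
  by_cases h : a i = 0
  · rw [h, pow_zero]
    exact one_mem _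
  · exact pow_mem (Algebra.subset_adjoin (Set.mem_image_of_mem _ (ha i h))) _

variable {s : Fin n} {y : SkewPolynomialRing k p}

/-- The algebra map `x_s ↦ x_s + y t`, `x_i ↦ x_i` for `i ≠ s`. -/
noncomputable def shift (hp : IsMultAntisymm p)
    (hy : ∀ i, x k p i * y = (p s i : k) • (y * x k p i)) :
    SkewPolynomialRing k p →ₐ[k] (SkewPolynomialRing k p)[X] :=
  lift (fun i => C (x k p i) + if i = s then C y * X else 0) fun i j hij => by
    have hx := x_mul_x (k := k) (p := p) i j hij
    rcases eq_or_ne i s with rfl | hi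
    · rw [if_pos rfl, if_neg hij.ne', add_zero, mul_add, ← C_mul, hx, ← mul_assoc, ← C_mul, hy,
        add_mul, mul_assoc (C y), X_mul_C, ← mul_assoc, ← C_mul, ← C_mul, smul_add, ← smul_C,
        ← smul_C, smul_mul_assoc]
    · rw [if_neg hi, add_zero]
      rcases eq_or_ne j s with rfl | hj
      · have hy' : y * x k p i = (p i j : k) • (x k p i * y) := by
          rw [hy, smul_smul, hp.inv i j, Units.mul_inv, one_smul]
        rw [if_pos rfl, add_mul, ← C_mul, hx, mul_assoc, X_mul_C, ← mul_assoc, ← C_mul, hy',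
          mul_add, ← C_mul, ← mul_assoc, ← C_mul, smul_add, ← smul_C, ← smul_C, smul_mul_assoc]
      · rw [if_neg hj, add_zero, ← C_mul, ← C_mul, hx, smul_C]

variable (hp : IsMultAntisymm p) (hy : ∀ i, x k p i * y = (p s i : k) • (y * x k p i))

theorem shift_x (i : Fin n) :
    shift hp hy (x k p i) = C (x k p i) + if i = s then C y * X else 0 :=
  lift_x _ _ _

theorem shift_of_mem {z : SkewPolynomialRing k p} (hz : z ∈ Algebra.adjoin k (x k p '' {s}ᶜ)) :
    shift hp hy z = C z := by
  induction hz using Algebra.adjoin_induction with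
  | mem z hz =>
    obtain ⟨i, hi, rfl⟩ := hz
    have hi' : i ≠ s := hi
    rw [shift_x, if_neg hi', add_zero]
  | algebraMap r => rw [AlgHom.commutes]; rfl
  | add a b _ _ ha hb => rw [map_add, ha, hb, C_add]
  | mul a b _ _ ha hb => rw [map_mul, ha, hb, C_mul]

theorem shift_coeff_zero (a : SkewPolynomialRing k p) : (shift hp hy a).coeff 0 = a := by
  have ha : a ∈ Algebra.adjoin k (Set.range (x k p)) := by rw [adjoin_range_x]; trivial
  induction ha using Algebra.adjoin_induction with
  | mem z hz =>
    obtain ⟨i, rfl⟩ := hz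
    rw [shift_x]
    split_ifs <;> simp
  | algebraMap r => rw [AlgHom.commutes]; exact coeff_C_zero
  | add a b _ _ ha hb => rw [map_add, coeff_add, ha, hb]
  | mul a b _ _ ha hb => rw [map_mul, mul_coeff_zero, ha, hb]

/-- The extension of `shift` to `A[t]` fixing `t`. -/
noncomputable def shiftPoly : (SkewPolynomialRing k p)[X] →ₐ[k] (SkewPolynomialRing k p)[X] :=
  eval₂AlgHom (shift hp hy) X fun _ => (commute_X _).symm

theorem shiftPoly_C (a : SkewPolynomialRing k p) : shiftPoly hp hy (C a) = shift hp hy a :=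
  eval₂_C _ _

theorem shiftPoly_X : shiftPoly hp hy X = X :=
  eval₂_X _ _

/-- Since `y` does not involve `x_s`, it is fixed by the shift, so the two translations cancel. -/
theorem shiftPoly_comp_neg (hy' : ∀ i, x k p i * -y = (p s i : k) • (-y * x k p i))
    (hmem : y ∈ Algebra.adjoin k (x k p '' {s}ᶜ)) :
    (shiftPoly hp hy).comp (shiftPoly hp hy') = AlgHom.id k _ := by
  refine algHom_ext' (SkewPolynomialRing.algHom_ext fun i => ?_) ?_
  · simp only [AlgHom.comp_apply, CAlgHom_apply, shiftPoly_C, shift_x, map_add, AlgHom.id_apply]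
    split_ifs
    · rw [map_mul, shiftPoly_C, shiftPoly_X, map_neg, shift_of_mem hp hy hmem, neg_mul]
      abel
    · simp
  · simp only [AlgHom.comp_apply, shiftPoly_X, AlgHom.id_apply]

theorem neg_comm (hy : ∀ i, x k p i * y = (p s i : k) • (y * x k p i)) (i : Fin n) :
    x k p i * -y = (p s i : k) • (-y * x k p i) := by
  rw [mul_neg, hy, neg_mul, smul_neg]

/-- The higher derivation attached to `shift`. -/
noncomputable def shiftDerivation : HigherDerivation k (SkewPolynomialRing k p) :=
  HigherDerivation.ofAlgHom (shift hp hy) (shift_coeff_zero hp hy)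

theorem shiftDerivation_isLocallyNilpotent (hmem : y ∈ Algebra.adjoin k (x k p '' {s}ᶜ)) :
    (shiftDerivation hp hy).IsLocallyNilpotent where
  eventually_zero a := ⟨(shift hp hy a).natDegree + 1, fun i hi =>
    coeff_eq_zero_of_natDegree_lt hi⟩
  automorphism := by
    have h1 := shiftPoly_comp_neg hp hy (neg_comm hy) hmem
    have h2 := shiftPoly_comp_neg hp (neg_comm hy) (by simpa using hy) (neg_mem hmem)
    simp only [neg_neg] at h2
    refine ⟨AlgEquiv.ofAlgHom _ _ h1 h2, shiftPoly_X hp hy, fun a i => ?_⟩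
    change (shiftPoly hp hy (C a)).coeff i = _
    rw [shiftPoly_C]
    rfl

/-- Binomial theorem for `(x_s + y t) ^ r`: the summands commute because `p s s = 1`. -/
theorem shiftDerivation_apply {z : SkewPolynomialRing k p}
    (hz : z ∈ Algebra.adjoin k (x k p '' {s}ᶜ)) (r i : ℕ) :
    (shiftDerivation hp hy).D i (z * x k p s ^ r) =
      r.choose i • (z * y ^ i * x k p s ^ (r - i)) := by
  have hcomm : Commute (C y * X) (C (x k p s)) := by
    have h1 : C y * C (x k p s) = C (x k p s) * C y := by
      rw [← C_mul, ← C_mul, hy, hp.diag, Units.val_one, one_smul]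
    exact Commute.mul_left h1 (commute_X _)
  have hpow : ∀ j, (C y * X) ^ j = C (y ^ j) * X ^ j := fun j => by
    rw [(commute_X (C y)).symm.mul_pow, C_pow]
  rw [shiftDerivation, HigherDerivation.ofAlgHom_D, map_mul, shift_of_mem hp hy hz, map_pow,
    shift_x, if_pos rfl, add_comm, hcomm.add_pow, coeff_C_mul, finsetSum_coeff]
  have hterm : ∀ j, ((C y * X) ^ j * C (x k p s) ^ (r - j) *
      (r.choose j : (SkewPolynomialRing k p)[X])).coeff i =
      if j = i then r.choose i • (y ^ i * x k p s ^ (r - i)) else 0 := by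
    intro j
    rw [← nsmul_eq_mul', coeff_smul, hpow, ← C_pow, coeff_mul_C, coeff_C_mul, coeff_X_pow]
    by_cases h : j = i
    · subst h; simp
    · rw [if_neg (Ne.symm h), if_neg h, mul_zero, zero_mul, smul_zero]
  simp only [hterm, Finset.sum_ite_eq', Finset.mem_range]
  split_ifs with h
  · rw [mul_smul_comm, mul_assoc]
  · rw [Nat.choose_eq_zero_of_lt (by omega), zero_smul, mul_zero]

theorem exists_mono_eq_update_mul (hp : IsMultAntisymm p) (s : Fin n) (a : Fin n → ℕ) :
    ∃ u : kˣ, mono k p a = (u : k) • (mono k p (Function.update a s 0) * x k p s ^ a s) := by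
  obtain ⟨u, hu⟩ := mono_mul_mono (k := k) hp (Function.update a s 0) (Pi.single s (a s))
  have h : Function.update a s 0 + Pi.single s (a s) = a := by
    ext j
    rcases eq_or_ne j s with rfl | hj
    · simp
    · simp [hj]
  refine ⟨u⁻¹, ?_⟩
  rw [← mono_single, hu, h, smul_smul, Units.inv_mul, one_smul]

theorem mono_update_mem (s : Fin n) (a : Fin n → ℕ) :
    mono k p (Function.update a s 0) ∈ Algebra.adjoin k (x k p '' {s}ᶜ) := by
  refine mono_mem_adjoin fun i hi h => hi ?_
  rw [Set.mem_singleton_iff.1 h, Function.update_self]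

theorem shiftDerivation_isIterative (hmem : y ∈ Algebra.adjoin k (x k p '' {s}ᶜ)) :
    (shiftDerivation hp hy).IsIterative := by
  intro i j a
  set d := shiftDerivation hp hy with hd
  have key : d.D i ∘ₗ d.D j = (i + j).choose i • d.D (i + j) := by
    refine (monoBasis hp).ext fun v => ?_
    obtain ⟨u, hu⟩ := exists_mono_eq_update_mul (k := k) hp s v
    have hv := mono_update_mem (k := k) (p := p) s v
    simp only [LinearMap.comp_apply, LinearMap.smul_apply, monoBasis_apply]
    rw [hu, map_smul, map_smul, hd, shiftDerivation_apply hp hy hv, map_nsmul, map_smul,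
      shiftDerivation_apply hp hy (mul_mem hv (pow_mem hmem _)),
      shiftDerivation_apply hp hy hv, smul_comm ((i + j).choose i), smul_smul, smul_smul,
      mul_assoc (mono k p _), ← pow_add, add_comm j i, Nat.sub_sub, add_comm j i]
    congr 2
    rw [mul_comm ((i + j).choose i), Nat.choose_symm_add, Nat.choose_mul (Nat.le_add_left j i),
      Nat.add_sub_cancel]
  exact LinearMap.congr_fun key a

/-- Let `w s` be the largest exponent of `x_s` occurring in `a`. Applying the derivation of order `w
s` kills all lower terms and turns each top `x_s ^ w s` into `y ^ w s` with binomial coefficient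
one, so nothing is lost in any characteristic. Cancelling `y ^ w s` contradicts `w s > 0`. -/
theorem apply_eq_zero_of_mem_ker_shiftDerivation [IsDomain k] (hy0 : y ≠ 0)
    {a : SkewPolynomialRing k p} (ha : a ∈ (shiftDerivation hp hy).ker) {v : Fin n → ℕ}
    (hv : (monoBasis hp).repr a v ≠ 0) : v s = 0 := by
  have := (isMonomialBasis_monoBasis (k := k) hp).noZeroDivisors
  set m := monoBasis (k := k) hp
  obtain ⟨w, hw, hmax⟩ := Finset.exists_max_image (m.repr a).support (fun v => v s)
    ⟨v, Finsupp.mem_support_iff.2 hv⟩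
  by_contra hv0
  have hle := hmax v (Finsupp.mem_support_iff.2 hv)
  choose u hu using exists_mono_eq_update_mul (k := k) hp s
  have h0 : (shiftDerivation hp hy).D (w s) a = 0 := ha (w s) (by omega)
  have h1 : (shiftDerivation hp hy).D (w s) a =
      (∑ t ∈ (m.repr a).support, (if t s = w s then m.repr a t * u t else 0) •
        m (Function.update t s 0)) * y ^ w s := by
    conv_lhs => rw [← m.linearCombination_repr a, Finsupp.linearCombination_apply, Finsupp.sum]
    rw [map_sum, Finset.sum_mul]
    refine Finset.sum_congr rfl fun t ht => ?_
    rw [map_smul, monoBasis_apply, monoBasis_apply, hu t, map_smul,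
      shiftDerivation_apply hp hy (mono_update_mem s t)]
    have htw := hmax t ht
    by_cases h : t s = w s
    · rw [if_pos h, h, Nat.choose_self, one_smul, Nat.sub_self, pow_zero, mul_one, smul_smul,
        smul_mul_assoc]
    · rw [if_neg h, Nat.choose_eq_zero_of_lt (by omega), zero_smul, smul_zero, smul_zero, zero_smul,
        zero_mul]
  rw [h0] at h1
  have h2 := (mul_eq_zero.1 h1.symm).resolve_right (pow_ne_zero _ hy0)
  have h3 := congrArg (fun z => m.repr z (Function.update w s 0)) h2
  simp only [map_sum, map_smul, Basis.repr_self, Finsupp.smul_single, smul_eq_mul, mul_one,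
    map_zero, Finsupp.coe_finsetSum, Finset.sum_apply, Finsupp.zero_apply] at h3
  rw [Finset.sum_eq_single w] at h3
  · rw [if_pos rfl, Finsupp.single_eq_same] at h3
    exact mul_ne_zero (Finsupp.mem_support_iff.1 hw) (u w).ne_zero h3
  · intro t _ htw
    split_ifs with h
    · refine Finsupp.single_eq_of_ne fun heq => htw ?_
      ext j
      rcases eq_or_ne j s with rfl | hj
      · rw [h]
      · simpa [hj] using (congrFun heq j).symm
    · simp
  · intro h
    exact absurd hw h

end Shift

/-! ### The Makar-Limanov invariants -/

variable {k : Type*} [CommRing k] {n : ℕ} {p : Fin n → Fin n → kˣ}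

theorem exists_monomial_of_mem_exponentSet (hp : IsMultAntisymm p) {s : Fin n}
    {d : {j : Fin n // j ≠ s} → ℕ} (hd : d ∈ exponentSet p s) :
    ∃ a : Fin n → ℕ, a s = 0 ∧
      ∀ i, x k p i * mono k p a = (p s i : k) • (mono k p a * x k p i) := by
  set a : Fin n → ℕ := fun j => if h : j ≠ s then d ⟨j, h⟩ else 0 with ha
  have has : a s = 0 := by simp [ha]
  have hne : ∀ i, i ≠ s → ∏ j, p i j ^ a j = p i s := by
    intro i hi
    rw [Fintype.prod_eq_mul_prod_subtype_ne _ s, has, pow_zero, one_mul, ← hd i hi]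
    refine Finset.prod_congr rfl fun j _ => ?_
    simp [ha, j.2]
  have hs : ∏ j, p s j ^ a j = 1 := by
    -- `T_s` imposes no condition at `i = s`; it follows from antisymmetry. The factors at `(i, j)`
    -- and `(j, i)` cancel, while the conditions at `i ≠ s` identify this product with `∏ i, p i s ^
    -- a i`.
    have h1 : ∏ i, (∏ j, p i j ^ a j) ^ a i = 1 := by
      simp only [← Finset.prod_pow, ← pow_mul]
      rw [← Fintype.prod_prod_type' fun i j => p i j ^ (a j * a i)]
      refine Finset.prod_involution (fun ij _ => ij.swap) ?_ ?_ ?_ ?_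
      · intro ij _
        rw [Prod.fst_swap, Prod.snd_swap, hp.inv ij.1 ij.2, mul_comm (a ij.1), inv_pow,
          mul_inv_cancel]
      · intro ij _ h heq
        refine h ?_
        have : ij.2 = ij.1 := congrArg Prod.fst heq
        rw [this, hp.diag, one_pow]
      · intro ij _; simp
      · intro ij _; simp
    have h2 : ∏ i, (∏ j, p i j ^ a j) ^ a i = ∏ i, p i s ^ a i := by
      refine Finset.prod_congr rfl fun i _ => ?_
      rcases eq_or_ne i s with rfl | hi
      · rw [has, pow_zero, pow_zero]
      · rw [hne i hi]
    rw [← inv_inj, ← Finset.prod_inv_distrib, inv_one, ← h1, h2]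
    refine Finset.prod_congr rfl fun i _ => ?_
    rw [hp.inv i s, inv_pow, inv_inv]
  refine ⟨a, has, fun i => ?_⟩
  rw [x_mul_mono_comm hp]
  congr 2
  have : commChar (fun i j => p j i) a i = (∏ j, p i j ^ a j)⁻¹ := by
    rw [commChar, ← Finset.prod_inv_distrib]
    refine Finset.prod_congr rfl fun j _ => ?_
    rw [hp.inv i j, inv_pow]
  rw [this]
  rcases eq_or_ne i s with rfl | hi
  · rw [hs, hp.diag, inv_one]
  · rw [hne i hi, ← hp.inv i s]

theorem MLI_le [IsDomain k] (hp : IsMultAntisymm p) :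
    MLI k (SkewPolynomialRing k p) ≤
      Algebra.adjoin k (x k p '' {s | exponentSet p s = ∅}) := by
  intro a ha
  rw [← (monoBasis hp).linearCombination_repr a, Finsupp.linearCombination_apply]
  refine Subalgebra.sum_mem _ fun v hv => Subalgebra.smul_mem _ ?_ _
  rw [monoBasis_apply]
  refine mono_mem_adjoin fun s hs => ?_
  by_contra hT
  obtain ⟨d, hd⟩ := Set.nonempty_iff_ne_empty.2 hT
  obtain ⟨b, hb, hy⟩ := exists_monomial_of_mem_exponentSet (k := k) hp hd
  have hmem : mono k p b ∈ Algebra.adjoin k (x k p '' {s}ᶜ) := by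
    refine mono_mem_adjoin fun i hi h => hi ?_
    rw [Set.mem_singleton_iff.1 h, hb]
  have hker : a ∈ (shiftDerivation hp hy).ker := by
    simp only [MLI, Algebra.mem_iInf] at ha
    exact ha _ ⟨shiftDerivation_isLocallyNilpotent hp hy hmem,
      shiftDerivation_isIterative hp hy hmem⟩
  have hne : mono k p b ≠ 0 := by
    rw [← monoBasis_apply hp]
    exact (monoBasis hp).ne_zero b
  exact hs (apply_eq_zero_of_mem_ker_shiftDerivation hp hy hne hker (Finsupp.mem_support_iff.1 hv))

theorem MLH_le_MLI (k A : Type*) [CommRing k] [Ring A] [Algebra k A] : MLH k A ≤ MLI k A :=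
  le_iInf₂ fun d hd => iInf₂_le d hd.1

/-- In a central monomial with `x_s`-exponent one, the remaining factor has character inverse to
that of `x_s`. Its power `l - 1` inverts it again, since `l` annihilates all characters, and gives
an element of `T_s`. -/
theorem ne_one_of_exponentSet_eq_empty (hp : IsMultAntisymm p) {l : ℕ} (hl : 0 < l)
    (hq : ∀ i j, p i j ^ l = 1) {s : Fin n} (hs : exponentSet p s = ∅) {v : Fin n → ℕ}
    (hv : commChar (fun i j => p j i) v = 1) : v s ≠ 1 := by
  intro hvs
  have hmem : (fun j : {j : Fin n // j ≠ s} => (l - 1) * v j) ∈ exponentSet p s := by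
    intro i _
    have h1 : ∏ j, p i j ^ v j = 1 := by
      rw [← inv_inj, ← Finset.prod_inv_distrib, inv_one]
      refine Eq.trans (Finset.prod_congr rfl fun j _ => ?_) (congrFun hv i)
      exact (inv_pow _ _).symm.trans (congrArg (· ^ v j) (hp.inv i j).symm)
    rw [Fintype.prod_eq_mul_prod_subtype_ne _ s, hvs, pow_one] at h1
    rw [eq_inv_of_mul_eq_one_left h1]
    refine eq_inv_of_mul_eq_one_left ?_
    rw [← Finset.prod_mul_distrib]
    refine Finset.prod_eq_one fun j _ => ?_
    rw [← pow_add, ← Nat.succ_mul, Nat.succ_eq_add_one, Nat.sub_add_cancel hl, pow_mul, hq, one_pow]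
  rw [hs] at hmem
  exact hmem

theorem exists_pow_eq_one (hroot : ∀ i j, IsOfFinOrder (p i j)) :
    ∃ l, 0 < l ∧ ∀ i j, p i j ^ l = 1 := by
  refine ⟨∏ i, ∏ j, orderOf (p i j),
    Finset.prod_pos fun i _ => Finset.prod_pos fun j _ => (hroot i j).orderOf_pos, fun i j => ?_⟩
  rw [← orderOf_dvd_iff_pow_eq_one]
  exact (Finset.dvd_prod_of_mem (fun j => orderOf (p i j)) (Finset.mem_univ j)).trans
    (Finset.dvd_prod_of_mem (fun i => ∏ j, orderOf (p i j)) (Finset.mem_univ i))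

theorem adjoin_le_MLH [IsDomain k] (hp : IsMultAntisymm p)
    (hroot : ∀ i j, IsOfFinOrder (p i j)) :
    Algebra.adjoin k (x k p '' {s | exponentSet p s = ∅}) ≤ MLH k (SkewPolynomialRing k p) := by
  obtain ⟨l, hl, hq⟩ := exists_pow_eq_one hroot
  refine Algebra.adjoin_le ?_
  rintro _ ⟨s, hs, rfl⟩
  simp only [MLH, SetLike.mem_coe, Algebra.mem_iInf]
  intro d hd i hi
  have := (isMonomialBasis_monoBasis (k := k) hp).higherDerivation_eq_zero hl (fun i j => hq j i)
    (fun v hv => ne_one_of_exponentSet_eq_empty hp hl hq hs hv) hd hi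
  rwa [monoBasis_apply, mono_single, pow_one] at this

/-! ### Subrings generated by some of the variables -/

section SubVariables

variable {r : ℕ} (e : Fin r ↪o Fin n)

/-- The inclusion of the skew polynomial ring in the variables picked out by `e`. -/
noncomputable def incl : SkewPolynomialRing k (fun i j => p (e i) (e j)) →ₐ[k]
    SkewPolynomialRing k p :=
  lift (fun i => x k p (e i)) fun i j h => x_mul_x (e i) (e j) (e.strictMono h)

theorem incl_x (i : Fin r) : incl (p := p) e (x k _ i) = x k p (e i) :=
  lift_x _ _ i

theorem range_incl : (incl (k := k) (p := p) e).range =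
    Algebra.adjoin k (x k p '' Set.range e) := by
  rw [← Algebra.map_top, ← adjoin_range_x, AlgHom.map_adjoin, ← Set.range_comp, ← Set.range_comp]
  congr 2
  ext1 i
  exact incl_x e i

/-- Distinct basis monomials go to unit multiples of distinct basis monomials. -/
theorem incl_injective (hp : IsMultAntisymm p) : Function.Injective (incl (k := k) (p := p) e) := by
  have hp' : IsMultAntisymm fun i j => p (e i) (e j) :=
    ⟨fun i => hp.diag _, fun i j => hp.inv _ _⟩
  have himage : ∀ a : Fin r → ℕ, ∃ u : kˣ,
      incl (p := p) e (mono k _ a) = (u : k) • mono k p (∑ j, Pi.single (e j) (a j)) := by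
    intro a
    obtain ⟨u, hu⟩ := list_prod_mul_mono (k := k) hp e a 0 (List.finRange r)
    refine ⟨u, ?_⟩
    rw [mono_zero, mul_one, add_zero] at hu
    rw [mono, map_list_prod, List.map_map, Fin.sum_univ_def, ← hu]
    congr 2
    ext1 j
    rw [Function.comp_apply, map_pow, incl_x]
  choose u hu using himage
  have hinj : Function.Injective fun a : Fin r → ℕ => ∑ j, (Pi.single (e j) (a j) : Fin n → ℕ) := by
    intro a b hab
    ext i
    have key : ∀ c : Fin r → ℕ, (∑ j, (Pi.single (e j) (c j) : Fin n → ℕ)) (e i) = c i := by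
      intro c
      rw [Finset.sum_apply, Finset.sum_eq_single i]
      · simp
      · intro j _ hj
        exact Pi.single_eq_of_ne (fun h => hj (e.injective h).symm) _
      · simp
    rw [← key a, ← key b]
    exact congrFun hab (e i)
  have hli : LinearIndependent k ((incl (k := k) (p := p) e).toLinearMap ∘ monoBasis hp') := by
    convert ((linearIndependent_mono (k := k) (p := p)).comp _ hinj).units_smul u using 1
    ext1 a
    rw [Function.comp_apply, monoBasis_apply, AlgHom.toLinearMap_apply, hu]
    rfl
  exact LinearMap.injective_of_linearIndependent (monoBasis hp').span_eq hli

theorem exists_algEquiv (hp : IsMultAntisymm p) (S : Set (Fin n))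
    {T : Subalgebra k (SkewPolynomialRing k p)} (hT : T = Algebra.adjoin k (x k p '' S)) :
    ∃ (m : ℕ) (e : Fin m ↪o Fin n), Set.range e = S ∧
      ∃ φ : SkewPolynomialRing k (fun i j => p (e i) (e j)) ≃ₐ[k] T,
        ∀ i, (φ (x k (fun i j => p (e i) (e j)) i) : SkewPolynomialRing k p) = x k p (e i) := by
  classical
  have he : Set.range (S.toFinset.orderEmbOfFin rfl) = S := by
    rw [Finset.range_orderEmbOfFin, Set.coe_toFinset]
  refine ⟨_, S.toFinset.orderEmbOfFin rfl, he, ?_⟩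
  generalize S.toFinset.orderEmbOfFin rfl = e at he
  have hrange : (incl (k := k) (p := p) e).range = T := by rw [range_incl, he, hT]
  refine ⟨(AlgEquiv.ofInjective _ (incl_injective e hp)).trans (Subalgebra.equivOfEq _ _ hrange),
    fun i => ?_⟩
  exact incl_x e i

end SubVariables

end SkewPolynomialRing

theorem theorem6p2 {k : Type*} [CommRing k] [IsDomain k] {n : ℕ}
    (p : Fin n → Fin n → kˣ) (hp : IsMultAntisymm p) (hroot : ∀ i j, IsOfFinOrder (p i j)) :
    (CharZero k →
      MLI k (SkewPolynomialRing k p) =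
        Algebra.adjoin k (SkewPolynomialRing.x k p '' {s | exponentSet p s = ∅}) ∧
      ∃ (m : ℕ) (e : Fin m ↪o Fin n), Set.range e = {s | exponentSet p s = ∅} ∧
        ∃ φ : SkewPolynomialRing k (fun i j => p (e i) (e j)) ≃ₐ[k]
            MLI k (SkewPolynomialRing k p),
          ∀ i, (φ (SkewPolynomialRing.x k (fun i j => p (e i) (e j)) i) :
            SkewPolynomialRing k p) = SkewPolynomialRing.x k p (e i)) ∧
    (MLH k (SkewPolynomialRing k p) =
        Algebra.adjoin k (SkewPolynomialRing.x k p '' {s | exponentSet p s = ∅}) ∧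
      ∃ (m : ℕ) (e : Fin m ↪o Fin n), Set.range e = {s | exponentSet p s = ∅} ∧
        ∃ φ : SkewPolynomialRing k (fun i j => p (e i) (e j)) ≃ₐ[k]
            MLH k (SkewPolynomialRing k p),
          ∀ i, (φ (SkewPolynomialRing.x k (fun i j => p (e i) (e j)) i) :
            SkewPolynomialRing k p) = SkewPolynomialRing.x k p (e i)) := by
  have hle := SkewPolynomialRing.MLH_le_MLI k (SkewPolynomialRing k p)
  have hI := SkewPolynomialRing.MLI_le (k := k) hp
  have hH := SkewPolynomialRing.adjoin_le_MLH (k := k) hp hroot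
  have hMLI := hI.antisymm (hH.trans hle)
  have hMLH := (hle.trans hI).antisymm hH
  exact ⟨fun _ => ⟨hMLI, SkewPolynomialRing.exists_algEquiv hp _ hMLI⟩,
    hMLH, SkewPolynomialRing.exists_algEquiv hp _ hMLH⟩
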